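/- **Conventions.** Let $M$ be an $n$-manifold. Round (square) brackets on indices denote symmetrization (antisymmetrization) with weight one. Two torsion-free affine connections are projectively equivalent if their difference tensor is $2\sigma_{(i}\delta_{j)}{}^{k}$ for a one-form $\sigma$. Let $[\nabla]$ be a projective class of torsion-free connections and $[h]$ a conformal class of pseudo-Riemannian metrics. There is a unique aligned representative $\nabla\in[\nabla]$, characterized by $h^{pq}\nabla_i h_{pq}=n\,h^{pq}\nabla_p h_{qi}$ for all $h\in[h]$. Put $H_{ij}=|\det h|^{-1/n}h_{ij}$; indices are raised and lowered with $H$. The pair $([\nabla],[h])$ is an *AH structure* if its conformal torsion $\tfrac43 H^{kp}\nabla_{[i}H_{j]p}$ vanishes; its cubic torsion is then $\mathcal L_{ij}{}^k=H^{kp}\nabla_iH_{jp}$, and the conjugate AH structure is generated by $[h]$ and the connection $\nabla+\mathcal L_{ij}{}^k$. Let $R_{ijk}{}^l$ be the curvature of the aligned representative (with $R(X,Y)Z$ having components $X^iY^jZ^kR_{ijk}{}^l$), and put $R_{ij}=R_{pij}{}^p$, $Q_{ij}=R_{ip}{}^{p}{}_{j}$, $nF_{ij}=R_{ijp}{}^p$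 and $R=H^{ij}R_{ij}$ (the weighted scalar curvature). The AH structure is *proper* if $R$ vanishes nowhere. It is *Einstein* if the trace-free symmetric parts of $R_{ij}$ and of $Q_{ij}$ vanish and $\nabla_iR+n\nabla^pF_{ip}=0$. With $r(F)_{ijkl}=F_{ij}H_{kl}-F_{k[i}H_{j]l}+F_{l[i}H_{j]k}$, $B=R-r(F)$, $U_{ijkl}=\tfrac34\bigl(B_{i(jkl)}-B_{j(ikl)}\bigr)$, $U_{ij}=U_{pij}{}^p$ and $E_{ij}=-\tfrac1nU_{ij}$, the *anti-self-conjugate Weyl tensor* is $$E_{ijkl}=U_{ijkl}+2H_{l[i}E_{j]k}+2H_{k[i}E_{j]l}.$$ The AH structure is *(conjugate) projectively flat* if the projective class of $\nabla$ (of $\nabla+\mathcal L_{ij}{}^k$) contains, near every point, a flat torsion-free connection. **Theorem.** Let $G$ be a noncompact semisimple finite-dimensional real Lie group with Lie algebra $\mathfrak g$ and Killing form $B$. Let $h$ be the left-invariant pseudo-Riemannian metric on $G$ determined by $-B$, let $D$ be its Levi-Civita connection, let $0\neq x\in\mathfrak g$ be nilpotent (that is, $\operatorname{ad}x$ is nilpotent),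 and let $X$ be the left-invariant vector field determined by $x$. Then the connection $$\nabla_YZ=D_YZ+h(X,Y)\,h(X,Z)\,X$$ and $[h]$ generate an AH structure $([\nabla],[h])$ on $G$ whose aligned representative is $\nabla$. This AH structure is left-invariant, proper and Einstein, its anti-self-conjugate Weyl tensor is not identically zero, and it is neither projectively flat nor conjugate projectively flat. -/

import Mathlib

open scoped Manifold ContDiff

noncomputable section

/-- Finite-dimensional real normed spaces are complete. -/
instance AH.completeSpace_of_finiteDimensional {E : Type*} [NormedAddCommGroup E]
    [NormedSpace ℝ E] [FiniteDimensional ℝ E] : CompleteSpace E :=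
  FiniteDimensional.complete ℝ E

/-- A smooth Lie group has the regularity at which Mathlib puts the Lie bracket on its tangent
space at the identity. -/
instance AH.lieGroup_minSmoothness {E : Type*} [NormedAddCommGroup E] [NormedSpace ℝ E]
    {G : Type*} [TopologicalSpace G] [ChartedSpace E G] [Group G] [LieGroup 𝓘(ℝ, E) ∞ G] :
    LieGroup 𝓘(ℝ, E) (minSmoothness ℝ 3) G := by
  rw [minSmoothness_of_isRCLikeNormedField]
  infer_instance

namespace AH

/-! ### Traces on a finite-dimensional vector space -/

section Algebra

variable {V : Type*} [AddCommGroup V] [Module ℝ V] [FiniteDimensional ℝ V]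
  {W : Type*} [AddCommGroup W] [Module ℝ W]

/-- The trace `A_p^p` of an endomorphism `A` of `V`. -/
def endoTrace (A : V → V) : ℝ :=
  ∑ i, (Module.finBasis ℝ V).coord i (A (Module.finBasis ℝ V i))

/-- The components `g^{ij}` of the bivector dual to the bilinear form `g`, in the basis
`Module.finBasis ℝ V`. -/
def dualMetric (g : V → V → ℝ) :
    Matrix (Fin (Module.finrank ℝ V)) (Fin (Module.finrank ℝ V)) ℝ :=
  (Matrix.of fun i j => g (Module.finBasis ℝ V i) (Module.finBasis ℝ V j))⁻¹

/-- The metric trace `g^{pq} T_{pq}` of a bilinear map `T`. -/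
def metricTrace (g : V → V → ℝ) (T : V → V → W) : W :=
  ∑ i, ∑ j, dualMetric g i j • T (Module.finBasis ℝ V i) (Module.finBasis ℝ V j)

/-- The projection `P₁(B)_{ijkl} = (3/4) (B_{i(jkl)} - B_{j(ikl)})` of an algebraic curvature tensor
on its part symmetric in the last two indices. -/
def projSymm (B : V → V → V → V → ℝ) (i j k l : V) : ℝ :=
  let S : V → V → V → V → ℝ := fun a b c d =>
    (B a b c d + B a b d c + B a c b d + B a c d b + B a d b c + B a d c b) / 6
  3 / 4 * (S i j k l - S j i k l)

/-- `r(F)_{ijkl} = F_{ij} H_{kl} - F_{k[i} H_{j]l} + F_{l[i} H_{j]k}`. -/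
def rTensor (H F : V → V → ℝ) (i j k l : V) : ℝ :=
  F i j * H k l - (F k i * H j l - F k j * H i l) / 2 + (F l i * H j k - F l j * H i k) / 2

/-- The anti-self-conjugate Weyl tensor built from a metric `H`, a curvature tensor
`R i j k = R_{ijk}^p` and the Faraday form `F`. With `U = P₁(R - r(F))`, its trace `U_{ij} = U_{pij}^p`
and `E_{ij} = -(1/n) U_{ij}`, it is
`E_{ijkl} = U_{ijkl} + 2 H_{l[i} E_{j]k} + 2 H_{k[i} E_{j]l}`. -/
def weylE (H : V → V → ℝ) (R : V → V → V → V) (F : V → V → ℝ) (i j k l : V) : ℝ :=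
  let U : V → V → V → V → ℝ :=
    projSymm fun a b c d => H (R a b c) d - rTensor H F a b c d
  let E₂ : V → V → ℝ := fun b c =>
    -(metricTrace H fun p q => U p b c q) / (Module.finrank ℝ V : ℝ)
  U i j k l + (H l i * E₂ j k - H l j * E₂ i k) + (H k i * E₂ j l - H k j * E₂ i l)

end Algebra

/-! ### Affine connections and metrics on a manifold without boundary -/

section Manifold

variable {E : Type*} [NormedAddCommGroup E] [NormedSpace ℝ E] [FiniteDimensional ℝ E]
  {M : Type*} [TopologicalSpace M] [ChartedSpace E M]

instance (x : M) : FiniteDimensional ℝ (TangentSpace 𝓘(ℝ, E) x) :=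
  inferInstanceAs (FiniteDimensional ℝ E)

variable (E M) in
/-- Vector fields, without any regularity. -/
abbrev VField := (x : M) → TangentSpace 𝓘(ℝ, E) x

variable (E M) in
/-- Operators `Y ↦ ∇ Y` from vector fields to endomorphism fields; `cov Y x u` is `∇_u Y` at `x`. -/
abbrev CovOp := VField E M → (x : M) → TangentSpace 𝓘(ℝ, E) x →L[ℝ] TangentSpace 𝓘(ℝ, E) x

/-- An extension of the tangent vector `u` at `x` to a vector field which is smooth near `x` (with
constant coefficients in the preferred chart at `x`). Values of tensors on tangent vectors are
computed on such extensions. -/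
def ext [IsManifold 𝓘(ℝ, E) ∞ M] {x : M} (u : TangentSpace 𝓘(ℝ, E) x) : VField E M :=
  FiberBundle.extend E u

/-- The operator `cov` is a smooth torsion-free affine connection on the set `U`. -/
structure IsTorsionFreeConnectionOn [IsManifold 𝓘(ℝ, E) ∞ M] (cov : CovOp E M) (U : Set M) :
    Prop where
  isCovariantDerivativeOn : IsCovariantDerivativeOn E cov U
  smooth : ∀ (X Y : VField E M), ∀ x ∈ U, CMDiffAt ∞ (T% X) x → CMDiffAt ∞ (T% Y) x →
    CMDiffAt ∞ (T% (fun y => cov Y y (X y))) x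
  torsion_free : ∀ (X Y : VField E M), ∀ x ∈ U, MDiffAt (T% X) x → MDiffAt (T% Y) x →
    cov Y x (X x) - cov X x (Y x) = VectorField.mlieBracket 𝓘(ℝ, E) X Y x

variable (E M) in
/-- A smooth torsion-free affine connection on `M`. -/
structure Connection [IsManifold 𝓘(ℝ, E) ∞ M] where
  cov : CovOp E M
  isTorsionFreeConnection : IsTorsionFreeConnectionOn cov Set.univ

variable (E M) in
/-- A smooth pseudo-Riemannian metric on `M`. -/
structure PseudoMetric [IsManifold 𝓘(ℝ, E) ∞ M] where
  form : (x : M) → TangentSpace 𝓘(ℝ, E) x →L[ℝ] TangentSpace 𝓘(ℝ, E) x →L[ℝ] ℝ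
  symm : ∀ x u v, form x u v = form x v u
  nondegenerate : ∀ x u, (∀ v, form x u v = 0) → u = 0
  smooth : ∀ (X Y : VField E M) (x : M), CMDiffAt ∞ (T% X) x → CMDiffAt ∞ (T% Y) x →
    CMDiffAt ∞ (fun y => form y (X y) (Y y)) x

variable [IsManifold 𝓘(ℝ, E) ∞ M]

/-- The metric `h` at `x` as a plain function of two tangent vectors. -/
def PseudoMetric.at (h : PseudoMetric E M) (x : M) :
    TangentSpace 𝓘(ℝ, E) x → TangentSpace 𝓘(ℝ, E) x → ℝ :=
  fun u v => h.form x u v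

/-- `h' = f h` for a smooth positive function `f`. -/
def ConformallyEquivalent (h h' : PseudoMetric E M) : Prop :=
  ∃ f : M → ℝ, CMDiff ∞ f ∧ (∀ x, 0 < f x) ∧ ∀ x u v, h'.form x u v = f x * h.form x u v

/-! ### Curvature -/

/-- `R(X, Y) Z = ∇_X ∇_Y Z - ∇_Y ∇_X Z - ∇_{[X, Y]} Z`. -/
def curvatureField (cov : CovOp E M) (X Y Z : VField E M) : VField E M := fun x =>
  cov (fun y => cov Z y (Y y)) x (X x) - cov (fun y => cov Z y (X y)) x (Y x)
    - cov Z x (VectorField.mlieBracket 𝓘(ℝ, E) X Y x)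

/-- The curvature tensor `R_{ijk}^l` at `x`: `curv cov x u v w` is `R(u, v) w`. -/
def curv (cov : CovOp E M) (x : M) (u v w : TangentSpace 𝓘(ℝ, E) x) : TangentSpace 𝓘(ℝ, E) x :=
  curvatureField cov (ext u) (ext v) (ext w) x

/-- The Ricci curvature `R_{ij} = R_{pij}^p`. -/
def ricci (cov : CovOp E M) (x : M) (v w : TangentSpace 𝓘(ℝ, E) x) : ℝ :=
  endoTrace fun u => curv cov x u v w

/-- The second trace `Q_{ij} = R_{ip}^p_j` of the curvature (it depends only on the conformal class
of `h`). -/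
def ricciQ (cov : CovOp E M) (h : PseudoMetric E M) (x : M) (u v : TangentSpace 𝓘(ℝ, E) x) : ℝ :=
  metricTrace (h.at x) fun a b => h.at x (curv cov x u a b) v

/-- The representative `h^{ij} R_{ij}` of the weighted scalar curvature
`R = |det h|^{1/n} h^{ij} R_{ij}`. -/
def scal (cov : CovOp E M) (h : PseudoMetric E M) (x : M) : ℝ :=
  metricTrace (h.at x) (ricci cov x)

/-- The Faraday form, `n F_{ij} = R_{ijp}^p`. -/
def faraday (cov : CovOp E M) (x : M) (u v : TangentSpace 𝓘(ℝ, E) x) : ℝ :=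
  (Module.finrank ℝ E : ℝ)⁻¹ * endoTrace fun w => curv cov x u v w

/-- The covariant derivative of the Faraday form: `nablaFaraday cov x v w u` is `(∇_u F)(v, w)`. -/
def nablaFaraday (cov : CovOp E M) (x : M) (v w u : TangentSpace 𝓘(ℝ, E) x) : ℝ :=
  mvfderiv 𝓘(ℝ, E) (fun y => faraday cov y (ext v y) (ext w y)) x u
    - faraday cov x (cov (ext v) x u) w - faraday cov x v (cov (ext w) x u)

/-! ### Covariant derivative of a metric, alignment, cubic torsion -/

/-- The covariant derivative of the metric: `nablaMetric cov h x v w u` is `(∇_u h)(v, w)`. -/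
def nablaMetric (cov : CovOp E M) (h : PseudoMetric E M) (x : M) (v w : TangentSpace 𝓘(ℝ, E) x) :
    TangentSpace 𝓘(ℝ, E) x →L[ℝ] ℝ :=
  mvfderiv 𝓘(ℝ, E) (fun y => h.form y (ext v y) (ext w y)) x
    - (h.form x w).comp (cov (ext v) x) - (h.form x v).comp (cov (ext w) x)

/-- The connection is aligned with `h`: `h^{pq} ∇_i h_{pq} = n h^{pq} ∇_p h_{qi}`. -/
def Aligned (cov : CovOp E M) (h : PseudoMetric E M) : Prop :=
  ∀ x (u : TangentSpace 𝓘(ℝ, E) x),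
    metricTrace (h.at x) (fun p q => nablaMetric cov h x p q u) =
      (Module.finrank ℝ E : ℝ) * metricTrace (h.at x) (fun p q => nablaMetric cov h x q u p)

/-- The Faraday primitive of `h`, `2 n γ_i = h^{pq} ∇_i h_{pq}`. -/
def faradayPrimitive (cov : CovOp E M) (h : PseudoMetric E M) (x : M) :
    TangentSpace 𝓘(ℝ, E) x →L[ℝ] ℝ :=
  (2 * (Module.finrank ℝ E : ℝ))⁻¹ • metricTrace (h.at x) (nablaMetric cov h x)

/-- The covariant derivative of the normalized representative `H = |det h|^{-1/n} h`, divided by the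
density `|det h|^{-1/n}`: `∇_i h_{jk} - 2 γ_i h_{jk}`. Here `nablaNormalized cov h x v w u` is the
value at `(i, j, k) = (u, v, w)`. -/
def nablaNormalized (cov : CovOp E M) (h : PseudoMetric E M) (x : M)
    (v w : TangentSpace 𝓘(ℝ, E) x) : TangentSpace 𝓘(ℝ, E) x →L[ℝ] ℝ :=
  nablaMetric cov h x v w - (2 * h.form x v w) • faradayPrimitive cov h x

/-- The conformal torsion `(4/3) H^{kp} ∇_{[i} H_{j]p}` vanishes. -/
def NoConformalTorsion (cov : CovOp E M) (h : PseudoMetric E M) : Prop :=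
  ∀ x (u v w : TangentSpace 𝓘(ℝ, E) x),
    nablaNormalized cov h x v w u = nablaNormalized cov h x u w v

/-- The conjugate connection `∇ + L_{ij}^k`, where `L_{ij}^k = H^{kp} ∇_i H_{jp}` is the cubic
torsion (for a connection aligned with `h` and without conformal torsion). -/
def conjugateCov (cov : CovOp E M) (h : PseudoMetric E M) : CovOp E M := fun Y x =>
  cov Y x + ∑ i, ∑ j, dualMetric (h.at x) i j •
    (nablaNormalized cov h x (Y x) (Module.finBasis ℝ (TangentSpace 𝓘(ℝ, E) x) i)).smulRight
      (Module.finBasis ℝ (TangentSpace 𝓘(ℝ, E) x) j)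

/-! ### Projective equivalence -/

/-- Projective equivalence of torsion-free connections over `U`: the difference tensor is
`2 σ_{(i} δ_{j)}^k` for a one-form `σ`. -/
def ProjectivelyEquivalentOn (U : Set M) (cov cov' : CovOp E M) : Prop :=
  ∃ σ : (x : M) → TangentSpace 𝓘(ℝ, E) x →L[ℝ] ℝ,
    ∀ (Y : VField E M), ∀ x ∈ U, MDiffAt (T% Y) x → ∀ u,
      cov' Y x u = cov Y x u + σ x u • Y x + σ x (Y x) • u

/-- A torsion-free connection with vanishing curvature over `U`. -/
def IsFlatConnectionOn (cov : CovOp E M) (U : Set M) : Prop :=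
  IsTorsionFreeConnectionOn cov U ∧
    ∀ (X Y Z : VField E M), ∀ x ∈ U, CMDiffAt ∞ (T% X) x → CMDiffAt ∞ (T% Y) x →
      CMDiffAt ∞ (T% Z) x → curvatureField cov X Y Z x = 0

/-- The projective structure generated by `cov` is flat: near every point `cov` is projectively
equivalent to a flat torsion-free connection. -/
def IsProjectivelyFlat (cov : CovOp E M) : Prop :=
  ∀ x : M, ∃ U : Set M, IsOpen U ∧ x ∈ U ∧
    ∃ cov' : CovOp E M, IsFlatConnectionOn cov' U ∧ ProjectivelyEquivalentOn U cov cov'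

end Manifold

/-! ### AH structures -/

section AHStructure

variable (E : Type*) [NormedAddCommGroup E] [NormedSpace ℝ E] [FiniteDimensional ℝ E]
  (M : Type*) [TopologicalSpace M] [ChartedSpace E M] [IsManifold 𝓘(ℝ, E) ∞ M]

/-- A conformal projective pair `([∇], [h])`: a projective equivalence class of torsion-free
connections and a conformal class of pseudo-Riemannian metrics. -/
structure CPPair where
  proj : Set (Connection E M)
  conf : Set (PseudoMetric E M)
  isProjectiveStructure : ∃ D : Connection E M,
    proj = {D' : Connection E M | ProjectivelyEquivalentOn Set.univ D.cov D'.cov}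
  isConformalStructure : ∃ h : PseudoMetric E M,
    conf = {h' : PseudoMetric E M | ConformallyEquivalent h h'}

/-- An AH structure: a conformal projective pair whose conformal torsion vanishes. It comes with its
aligned representative, the element of the projective structure, unique by virtue of the alignment
condition, that is aligned with the conformal structure. -/
structure AHStructure extends CPPair E M where
  aligned : Connection E M
  aligned_mem : aligned ∈ proj
  isAligned : ∀ h ∈ conf, Aligned aligned.cov h
  noConformalTorsion : ∀ h ∈ conf, NoConformalTorsion aligned.cov h

variable {E M}

namespace AHStructure

variable (S : AHStructure E M)

/-- The weighted scalar curvature vanishes nowhere. -/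
def Proper : Prop :=
  ∀ h ∈ S.conf, ∀ x, scal S.aligned.cov h x ≠ 0

/-- The trace-free symmetric parts of both rank two traces of the curvature vanish. -/
def NaiveEinstein : Prop :=
  ∀ h ∈ S.conf, ∀ x (u v : TangentSpace 𝓘(ℝ, E) x),
    (ricci S.aligned.cov x u v + ricci S.aligned.cov x v u) / 2 =
        metricTrace (h.at x) (ricci S.aligned.cov x) / (Module.finrank ℝ E : ℝ) * h.at x u v ∧
    (ricciQ S.aligned.cov h x u v + ricciQ S.aligned.cov h x v u) / 2 =
        metricTrace (h.at x) (ricciQ S.aligned.cov h x) / (Module.finrank ℝ E : ℝ) * h.at x u v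

/-- The conservation condition `∇_i R + n ∇^p F_{ip} = 0` for the weighted scalar curvature `R`.
After division by `|det h|^{1/n}` the covariant derivative of the density
`R = |det h|^{1/n} h^{pq} R_{pq}` becomes `d(h^{pq} R_{pq}) + 2 γ h^{pq} R_{pq}`. -/
def Conservative : Prop :=
  ∀ h ∈ S.conf, ∀ x (u : TangentSpace 𝓘(ℝ, E) x),
    mvfderiv 𝓘(ℝ, E) (scal S.aligned.cov h) x u
      + 2 * faradayPrimitive S.aligned.cov h x u * scal S.aligned.cov h x
      + (Module.finrank ℝ E : ℝ) *
          metricTrace (h.at x) (fun p q => nablaFaraday S.aligned.cov x u q p) = 0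

/-- The Einstein condition for AH structures. -/
def Einstein : Prop := S.NaiveEinstein ∧ S.Conservative

/-- The anti-self-conjugate Weyl tensor `E_{ijkl}` at `x`, with the last index lowered by `h`. -/
def antiSelfConjugateWeyl (h : PseudoMetric E M) (x : M) (i j k l : TangentSpace 𝓘(ℝ, E) x) : ℝ :=
  weylE (h.at x) (curv S.aligned.cov x) (faraday S.aligned.cov x) i j k l

/-- The projective structure is flat. -/
def ProjectivelyFlat : Prop := ∀ D ∈ S.proj, IsProjectivelyFlat D.cov

/-- The projective structure of the conjugate AH structure is flat. -/
def ConjugateProjectivelyFlat : Prop :=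
  ∀ h ∈ S.conf, IsProjectivelyFlat (conjugateCov S.aligned.cov h)

end AHStructure

end AHStructure

/-! ### Left-invariance on Lie groups -/

section LieGroup

variable {E : Type*} [NormedAddCommGroup E] [NormedSpace ℝ E] [FiniteDimensional ℝ E]
  {G : Type*} [TopologicalSpace G] [ChartedSpace E G] [Group G] [LieGroup 𝓘(ℝ, E) ∞ G]

/-- Every left translation is an affine transformation of the connection. -/
def LeftInvariantConnection (cov : CovOp E G) : Prop :=
  ∀ (g : G) (Y : VField E G), MDiff (T% Y) → ∀ (x : G) (u : TangentSpace 𝓘(ℝ, E) x),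
    mfderiv 𝓘(ℝ, E) 𝓘(ℝ, E) (g * ·) x
        (cov (VectorField.mpullback 𝓘(ℝ, E) 𝓘(ℝ, E) (g * ·) Y) x u) =
      cov Y (g * x) (mfderiv 𝓘(ℝ, E) 𝓘(ℝ, E) (g * ·) x u)

/-- Every left translation preserves the projective and the conformal structure. -/
def LeftInvariant (S : AHStructure E G) : Prop :=
  LeftInvariantConnection S.aligned.cov ∧
    ∀ h ∈ S.conf, ∀ g : G, ∃ f : G → ℝ, CMDiff ∞ f ∧ (∀ x, 0 < f x) ∧
      ∀ x (u v : TangentSpace 𝓘(ℝ, E) x),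
        h.form (g * x) (mfderiv 𝓘(ℝ, E) 𝓘(ℝ, E) (g * ·) x u)
          (mfderiv 𝓘(ℝ, E) 𝓘(ℝ, E) (g * ·) x v) = f x * h.form x u v

end LieGroup

end AH

end

/-!
Left trivialization turns every assertion into a computation on the Lie algebra `𝔤`. Write `h` for
the negative of the Killing form, `θ = h(x, ·)` and `ω(a, b) = h(x, [a, b])`. On left-invariant
fields the Levi-Civita connection of `h` is `½ [a, b]`, so the connection in question has
Christoffel symbol `Γ_ε(a, b) = ½ [a, b] + ε θ(a) θ(b) x` (`christoffel`) with `ε = 1`; the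
parameter is kept because the conjugate connection turns out to be the one for `-ε`
(`conjugateCov_killingCov`).

Semisimplicity makes `h` nondegenerate (Cartan's criterion). Nilpotency of `ad x` enters through
`h(x, x) = 0` and `tr (ad x) = 0`. By the first of these the curvature of `Γ_ε` is
`-¼ [[a, b], c]` plus terms linear in `ε` (`lieCurv_christoffel`). Each trace of these linear terms
vanishes, so both rank two traces of the curvature are `h / 4` and the Faraday form is zero
(`exists_trace_lieCurv_eq_ricci`, `exists_trace_lieCurv_eq_ricciQ`,
`exists_trace_lieCurv_eq_faraday`). Since `∇h = -2 ε θ ⊗ θ ⊗ θ` is totally symmetric and trace-free,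
the connection is aligned and without conformal torsion, and the Einstein condition reduces to the
constancy of the scalar curvature `n / 4` of `h`. All members `f h` of the conformal class are
treated together; there `∇(f h) = df ⊗ h - 2 ε f θ ⊗ θ ⊗ θ` (`nablaMetric_killingCov`).

The symmetrization in the definition of the anti-self-conjugate Weyl tensor `E` annihilates the
Levi-Civita part of the curvature and turns the rest into a trace-free expression in `ω` and `θ`
(`cubicWeyl`). The value `E(a, c, c, c) = -2 ε ω(a, c) θ(c)²` is nonzero for suitable `a` and `c`
because `x` is neither zero nor central.

If the connection were projectively equivalent to a flat one near the identity, by a one-form `σ`,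
the curvature of `Γ_ε` would be given by `P = ∇σ - σ ⊗ σ` (`exists_lieCurv_add_eq_zero`). Taking the
trace gives `(n - 1) P = h / 4`, which leaves no room for the terms linear in `ε`
(`false_of_lieCurv_add_eq_zero`). This is applied to `ε = 1` and to `ε = -1`.

Curvatures of left-invariant connections are computed for arbitrary vector fields, because the
values of tensors are defined through extensions that are constant in a chart. This needs the
identity `[X, Y] f = X Y f - Y X f` on a manifold (`mvfderiv_mlieBracket`).
-/

noncomputable section

namespace AH

/-! ### Traces -/

section Traces

variable {V : Type*} [AddCommGroup V] [Module ℝ V] [FiniteDimensional ℝ V]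
  {L : Type*} [AddCommGroup L] [Module ℝ L]

theorem endoTrace_eq_trace (A : V →ₗ[ℝ] V) : endoTrace A = LinearMap.trace ℝ V A := by
  rw [LinearMap.trace_eq_matrix_trace ℝ (Module.finBasis ℝ V)]
  simp [endoTrace, Matrix.trace, LinearMap.toMatrix_apply]

theorem endoTrace_eq_trace_of_conj (φ : V ≃ₗ[ℝ] L) (A : L →ₗ[ℝ] L) {T : V → V}
    (hT : ∀ v, T v = φ.symm (A (φ v))) : endoTrace T = LinearMap.trace ℝ L A := by
  have h : T = φ.symm.conj A := by
    ext v
    simp [hT, LinearEquiv.conj_apply]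
  rw [h, endoTrace_eq_trace, LinearMap.trace_conj']

/-- Raising an index inverts lowering it: `g^{pq} g(c, ∂_p) ∂_q = c`. -/
theorem metricTrace_smul_self {g : V →ₗ[ℝ] V →ₗ[ℝ] ℝ} (hg : g.Nondegenerate) (c : V) :
    metricTrace (fun u v => g u v) (fun p q => g c p • q) = c := by
  set b := Module.finBasis ℝ V with hb
  set M : Matrix _ _ ℝ := LinearMap.BilinForm.toMatrix b g with hM
  have hdet : IsUnit M.det :=
    isUnit_iff_ne_zero.2 ((LinearMap.BilinForm.nondegenerate_iff_det_ne_zero b).1 hg)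
  have hD : dualMetric (fun u v => g u v) = M⁻¹ := by
    unfold dualMetric
    congr 1
    ext i j
    simp [hM, hb, LinearMap.BilinForm.toMatrix_apply]
  have hc : ∀ i, g c (b i) = ∑ k, b.repr c k * M k i := by
    intro i
    conv_lhs => rw [← b.sum_repr c]
    simp only [hM, LinearMap.BilinForm.toMatrix_apply, map_sum, map_smul, LinearMap.sum_apply,
      LinearMap.smul_apply, smul_eq_mul]
  have key : ∀ k j, ∑ i, M k i * M⁻¹ i j = if k = j then 1 else 0 := by
    intro k j
    rw [← Matrix.mul_apply, Matrix.mul_nonsing_inv _ hdet, Matrix.one_apply]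
  unfold metricTrace
  rw [hD, Finset.sum_comm]
  conv_rhs => rw [← b.sum_repr c]
  refine Finset.sum_congr rfl fun j _ => ?_
  simp only [smul_smul, ← Finset.sum_smul]
  congr 1
  calc ∑ i, M⁻¹ i j * g c (b i) = ∑ i, ∑ k, b.repr c k * (M k i * M⁻¹ i j) := by
        refine Finset.sum_congr rfl fun i _ => ?_
        rw [hc, Finset.mul_sum]
        exact Finset.sum_congr rfl fun k _ => by ring
    _ = b.repr c j := by
        rw [Finset.sum_comm]
        simp [← Finset.mul_sum, key]

theorem metricTrace_eq_trace {g : V →ₗ[ℝ] V →ₗ[ℝ] ℝ} (hg : g.Nondegenerate)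
    (hs : ∀ u v, g u v = g v u) (A : V →ₗ[ℝ] V) :
    metricTrace (fun u v => g u v) (fun p q => g (A p) q) = LinearMap.trace ℝ V A := by
  have hDs : ∀ i j, dualMetric (fun u v => g u v) i j = dualMetric (fun u v => g u v) j i := by
    intro i j
    unfold dualMetric
    rw [← Matrix.transpose_apply (Matrix.of _)⁻¹ j i, Matrix.transpose_nonsing_inv]
    refine congrFun (congrFun (congrArg (fun N : Matrix _ _ ℝ => N⁻¹) ?_) j) i
    ext k l
    simp [hs (Module.finBasis ℝ V k)]
  rw [← endoTrace_eq_trace]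
  refine Finset.sum_congr rfl fun i _ => ?_
  conv_rhs => rw [← metricTrace_smul_self hg (A (Module.finBasis ℝ V i))]
  simp only [metricTrace, map_sum, map_smul, Module.Basis.coord_apply, Module.Basis.repr_self]
  refine Finset.sum_congr rfl fun j _ => ?_
  simp [Finsupp.single_apply, hDs i j]

omit [FiniteDimensional ℝ V] in
theorem exists_nondegenerate_pullback (φ : V ≃ₗ[ℝ] L) {β : L →ₗ[ℝ] L →ₗ[ℝ] ℝ}
    (hβ : β.Nondegenerate) (hs : ∀ a b, β a b = β b a) {f : ℝ} (hf : f ≠ 0) :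
    ∃ g : V →ₗ[ℝ] V →ₗ[ℝ] ℝ, (∀ u v, g u v = f * β (φ u) (φ v)) ∧ (∀ u v, g u v = g v u) ∧
      g.Nondegenerate := by
  set g : V →ₗ[ℝ] V →ₗ[ℝ] ℝ := f • β.compl₁₂ φ.toLinearMap φ.toLinearMap with hgdef
  have hga : ∀ u v, g u v = f * β (φ u) (φ v) := fun u v => by simp [hgdef]
  have hsym : ∀ u v, g u v = g v u := fun u v => by rw [hga, hga, hs]
  have hg : g.Nondegenerate := by
    have hsep : ∀ u, (∀ v, g u v = 0) → u = 0 := by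
      intro u hu
      have : φ u = 0 := hβ.1 _ fun w => by
        have := hu (φ.symm w)
        rw [hga] at this
        simpa [hf] using this
      simpa using this
    exact ⟨hsep, fun v hv => hsep v fun u => by rw [hsym]; exact hv u⟩
  exact ⟨g, hga, hsym, hg⟩

/-- Metric traces on `V` computed in `L`, when the metric on `V` is a multiple of the pullback of a
metric on `L`. -/
theorem metricTrace_eq_trace_of_pullback (φ : V ≃ₗ[ℝ] L) {β : L →ₗ[ℝ] L →ₗ[ℝ] ℝ}
    (hβ : β.Nondegenerate) (hs : ∀ a b, β a b = β b a) {f : ℝ} (hf : f ≠ 0) (A : L →ₗ[ℝ] L)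
    {H T : V → V → ℝ} (hH : ∀ u v, H u v = f * β (φ u) (φ v))
    (hT : ∀ p q, T p q = β (A (φ p)) (φ q)) :
    metricTrace H T = f⁻¹ * LinearMap.trace ℝ L A := by
  obtain ⟨g, hga, hsym, hg⟩ := exists_nondegenerate_pullback φ hβ hs hf
  have hH' : H = fun u v => g u v := by
    ext u v; rw [hH, hga]
  have hT' : T = fun p q => g ((f⁻¹ • φ.symm.conj A) p) q := by
    ext p q
    rw [hT, hga]
    simp [LinearEquiv.conj_apply, hf]
  rw [hH', hT', metricTrace_eq_trace hg hsym]
  simp [LinearMap.trace_conj']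

/-- Raising an index on `V` computed in `L`. -/
theorem metricTrace_smul_of_pullback (φ : V ≃ₗ[ℝ] L) {β : L →ₗ[ℝ] L →ₗ[ℝ] ℝ}
    (hβ : β.Nondegenerate) (hs : ∀ a b, β a b = β b a) {f : ℝ} (hf : f ≠ 0) (c : L)
    {H : V → V → ℝ} (hH : ∀ u v, H u v = f * β (φ u) (φ v)) :
    metricTrace H (fun p q => (f * β c (φ p)) • q) = φ.symm c := by
  obtain ⟨g, hga, hsym, hg⟩ := exists_nondegenerate_pullback φ hβ hs hf
  have hH' : H = fun u v => g u v := by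
    ext u v; rw [hH, hga]
  rw [hH']
  conv_rhs => rw [← metricTrace_smul_self hg (φ.symm c)]
  simp [hga]

end Traces

/-! ### Left-invariant connections and curvature on the Lie algebra -/

section KillingCubic

attribute [local instance] LieRing.ofAssociativeRing

variable {L : Type*} [LieRing L] [LieAlgebra ℝ L]

/-- The negative of the Killing form. -/
def negKilling (L : Type*) [LieRing L] [LieAlgebra ℝ L] : L →ₗ[ℝ] L →ₗ[ℝ] ℝ := -killingForm ℝ L

theorem negKilling_comm (a b : L) : negKilling L a b = negKilling L b a := by
  simp [negKilling, LieModule.traceForm_comm ℝ L L a b]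

theorem negKilling_lie (a b c : L) : negKilling L ⁅a, b⁆ c = negKilling L a ⁅b, c⁆ := by
  simp [negKilling, LieModule.traceForm_apply_lie_apply]

theorem negKilling_self_lie (x a : L) : negKilling L x ⁅x, a⁆ = 0 := by
  rw [← negKilling_lie, lie_self]
  simp

theorem negKilling_lie_self (x a : L) : negKilling L x ⁅a, x⁆ = 0 := by
  rw [← lie_skew, map_neg, negKilling_self_lie, neg_zero]

theorem trace_ad_lie (a b : L) : LinearMap.trace ℝ L (LieAlgebra.ad ℝ L ⁅a, b⁆) = 0 := by
  rw [LieHom.map_lie, LieRing.of_associative_ring_bracket, map_sub, LinearMap.trace_mul_comm,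
    sub_self]

theorem trace_ad_comp_ad (a b : L) :
    LinearMap.trace ℝ L (LieAlgebra.ad ℝ L a ∘ₗ LieAlgebra.ad ℝ L b) = -negKilling L a b := by
  simp [negKilling, killingForm_apply_apply]

/-- The Christoffel symbol `Γ(a, b) = ½ [a, b] + ε h(x, a) h(x, b) x`, with `h` the negative of the
Killing form, of a left-invariant connection. For `ε = 0` it is the Levi-Civita connection of `h`,
and for `h(x, x) = 0` conjugation exchanges `ε` and `-ε`. -/
def christoffel (ε : ℝ) (x : L) : L →ₗ[ℝ] L →ₗ[ℝ] L :=
  (1 / 2 : ℝ) • (LieAlgebra.ad ℝ L).toLinearMap +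
    ε • (negKilling L x).smulRight ((negKilling L x).smulRight x)

theorem christoffel_apply (ε : ℝ) (x a b : L) :
    christoffel ε x a b =
      (1 / 2 : ℝ) • ⁅a, b⁆ + (ε * (negKilling L x a * negKilling L x b)) • x := by
  simp [christoffel, mul_smul]

theorem christoffel_sub_swap (ε : ℝ) (x a b : L) :
    christoffel ε x a b - christoffel ε x b a = ⁅a, b⁆ := by
  rw [christoffel_apply, christoffel_apply, ← lie_skew a b]
  module

/-- `-(∇_a h)(b, c)` on left-invariant fields. -/
theorem negKilling_christoffel_add (ε : ℝ) (x a b c : L) :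
    negKilling L (christoffel ε x a b) c + negKilling L b (christoffel ε x a c) =
      2 * ε * negKilling L x a * negKilling L x b * negKilling L x c := by
  have h1 : negKilling L ⁅a, b⁆ c = -negKilling L b ⁅a, c⁆ := by
    rw [← lie_skew, map_neg, LinearMap.neg_apply, negKilling_lie]
  simp only [christoffel_apply, map_add, map_smul, LinearMap.add_apply, LinearMap.smul_apply,
    smul_eq_mul, h1, negKilling_comm b x]
  ring

/-- The curvature `[Γ_a, Γ_b] c - Γ_{[a, b]} c` of the left-invariant connection with Christoffel
symbol `Γ`, at the identity. -/
def lieCurv (Γ : L → L → L) (a b c : L) : L := Γ a (Γ b c) - Γ b (Γ a c) - Γ ⁅a, b⁆ c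

variable {x : L}

theorem lieCurv_christoffel (hxx : negKilling L x x = 0) (ε : ℝ) (a b c : L) :
    lieCurv (fun u v => christoffel ε x u v) a b c =
      (-(1 / 4) : ℝ) • ⁅⁅a, b⁆, c⁆ +
      (ε * ((negKilling L x a * negKilling L x ⁅b, c⁆
        - negKilling L x b * negKilling L x ⁅a, c⁆) / 2
        - negKilling L x ⁅a, b⁆ * negKilling L x c)) • x +
      (ε * negKilling L x c * negKilling L x b / 2) • ⁅a, x⁆ -
      (ε * negKilling L x c * negKilling L x a / 2) • ⁅b, x⁆ := by
  simp only [lieCurv, christoffel_apply, map_add, map_smul, hxx,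
    lie_lie]
  module

theorem negKilling_nondegenerate [LieAlgebra.IsKilling ℝ L] : (negKilling L).Nondegenerate := by
  have h := LieAlgebra.IsKilling.killingForm_nondegenerate ℝ L
  exact ⟨fun a ha => h.1 a fun b => by simpa [negKilling] using ha b,
    fun a ha => h.2 a fun b => by simpa [negKilling] using ha b⟩

theorem negKilling_self_of_isNilpotent_ad (hx : IsNilpotent (LieAlgebra.ad ℝ L x)) :
    negKilling L x x = 0 := by
  have h : IsNilpotent (LieAlgebra.ad ℝ L x ∘ₗ LieAlgebra.ad ℝ L x) :=
    (Commute.refl _).isNilpotent_mul_left hx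
  rw [← neg_eq_zero, ← trace_ad_comp_ad]
  exact (LinearMap.isNilpotent_trace_of_isNilpotent h).eq_zero

theorem trace_ad_of_isNilpotent (hx : IsNilpotent (LieAlgebra.ad ℝ L x)) :
    LinearMap.trace ℝ L (LieAlgebra.ad ℝ L x) = 0 :=
  (LinearMap.isNilpotent_trace_of_isNilpotent hx).eq_zero

theorem exists_lie_ne_zero [LieAlgebra.IsKilling ℝ L] (hx : x ≠ 0) : ∃ b : L, ⁅b, x⁆ ≠ 0 := by
  by_contra! h
  refine hx (negKilling_nondegenerate.1 x fun b => ?_)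
  have h0 : LieAlgebra.ad ℝ L x = 0 := by
    ext b
    rw [LieAlgebra.ad_apply, ← lie_skew, h]
    simp
  rw [← neg_eq_zero, ← trace_ad_comp_ad, h0]
  simp

/-- Neither of the subspaces `h(x, c) = 0` and `[c, x] = 0` is everything, so their union is not
everything either. -/
theorem exists_negKilling_ne_zero_and_lie_ne_zero [LieAlgebra.IsKilling ℝ L] (hx : x ≠ 0) :
    ∃ c a : L, negKilling L x c ≠ 0 ∧ negKilling L x ⁅a, c⁆ ≠ 0 := by
  suffices h : ∃ c : L, negKilling L x c ≠ 0 ∧ ⁅c, x⁆ ≠ 0 by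
    obtain ⟨c, hc, hcx⟩ := h
    have : ∃ a, negKilling L ⁅c, x⁆ a ≠ 0 := by
      by_contra! h
      exact hcx (negKilling_nondegenerate.1 _ h)
    obtain ⟨a, ha⟩ := this
    refine ⟨c, a, hc, ?_⟩
    rwa [← negKilling_lie, negKilling_comm, ← negKilling_lie]
  obtain ⟨a, ha⟩ : ∃ a, negKilling L x a ≠ 0 := by
    by_contra! h
    exact hx (negKilling_nondegenerate.1 _ h)
  obtain ⟨b, hb⟩ := exists_lie_ne_zero hx
  by_cases hax : ⁅a, x⁆ = 0
  · by_cases hxb : negKilling L x b = 0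
    · exact ⟨a + b, by simpa [hxb] using ha, by simpa [hax] using hb⟩
    · exact ⟨b, hxb, hb⟩
  · exact ⟨a, ha, hax⟩

/-- The anti-self-conjugate Weyl tensor of `christoffel ε x` for `h(x, x) = 0`, namely
`-(ε/2)(2 ω_{ij} θ_k θ_l + ω_{ik} θ_j θ_l + ω_{il} θ_j θ_k - ω_{jk} θ_i θ_l
- ω_{jl} θ_i θ_k)` with `θ = h(x, ·)` and `ω_{ij} = h(x, [i, j])`. -/
def cubicWeyl (ε : ℝ) (x i j k l : L) : ℝ :=
  let θ := negKilling L x;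
  (-(ε / 2)) * (2 * θ ⁅i, j⁆ * θ k * θ l + θ ⁅i, k⁆ * θ j * θ l + θ ⁅i, l⁆ * θ j * θ k
    - θ ⁅j, k⁆ * θ i * θ l - θ ⁅j, l⁆ * θ i * θ k)

theorem exists_cubicWeyl_ne_zero [LieAlgebra.IsKilling ℝ L] (hx0 : x ≠ 0) {ε : ℝ} (hε : ε ≠ 0) :
    ∃ i j k l : L, cubicWeyl ε x i j k l ≠ 0 := by
  obtain ⟨c, a, hc, hac⟩ := exists_negKilling_ne_zero_and_lie_ne_zero (x := x) hx0
  refine ⟨a, c, c, c, ?_⟩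
  have : cubicWeyl ε x a c c c = -2 * ε * negKilling L x ⁅a, c⁆ * negKilling L x c ^ 2 := by
    simp only [cubicWeyl, lie_self, map_zero]
    ring
  rw [this]
  simp [hε, hc, hac]

/-- The Levi-Civita part of the curvature is antisymmetric in its last two indices and is killed by
the symmetrization. -/
theorem projSymm_lieCurv (hxx : negKilling L x x = 0) (ε f : ℝ) (i j k l : L) :
    projSymm (fun a b c d => f *
      negKilling L (lieCurv (fun u v => christoffel ε x u v) a b c) d) i j k l =
      f * cubicWeyl ε x i j k l := by
  have e1 : ∀ a b c d : L, negKilling L ⁅⁅a, b⁆, c⁆ d = negKilling L ⁅a, b⁆ ⁅c, d⁆ :=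
    fun a b c d => negKilling_lie _ _ _
  have e2 : ∀ a b : L, negKilling L ⁅a, x⁆ b = -negKilling L x ⁅a, b⁆ := by
    intro a b
    rw [← lie_skew, map_neg, LinearMap.neg_apply, negKilling_lie]
  have e3 : ∀ a b c d : L, negKilling L ⁅a, b⁆ ⁅c, d⁆ = -negKilling L ⁅a, b⁆ ⁅d, c⁆ := by
    intro a b c d
    rw [← lie_skew c d, map_neg]
  have e4 : ∀ a b : L, negKilling L x ⁅a, b⁆ = -negKilling L x ⁅b, a⁆ := by
    intro a b
    rw [← lie_skew a b, map_neg]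
  simp only [projSymm, lieCurv_christoffel hxx, cubicWeyl, map_add, map_sub, map_smul,
    LinearMap.add_apply, LinearMap.sub_apply, LinearMap.smul_apply, smul_eq_mul, e1, e2]
  rw [e3 i j l k, e3 i k l j, e3 i l k j, e3 j i l k, e3 j k l i, e3 j l k i, e4 j i, e4 l k,
    e4 k j, e4 l j, e4 k i, e4 l i]
  ring

variable [FiniteDimensional ℝ L]

/-- The Ricci trace `R_{pij}^p` of the curvature of `christoffel ε x` is `h / 4`. Existence of `A`
records that the map whose trace is taken is linear. -/
theorem exists_trace_lieCurv_eq_ricci (hx : IsNilpotent (LieAlgebra.ad ℝ L x)) (ε : ℝ) (v w : L) :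
    ∃ A : L →ₗ[ℝ] L, (∀ u, lieCurv (fun u v => christoffel ε x u v) u v w = A u) ∧
      LinearMap.trace ℝ L A = negKilling L v w / 4 := by
  have hxx := negKilling_self_of_isNilpotent_ad hx
  set θ := negKilling L x with hθ
  set ad := LieAlgebra.ad ℝ L with had
  refine ⟨(-(1 / 4) : ℝ) • ad w ∘ₗ ad v
    + (ε * θ ⁅v, w⁆ / 2) • θ.smulRight x
    + (ε * θ v / 2) • (θ ∘ₗ ad w).smulRight x
    + (ε * θ w) • (θ ∘ₗ ad v).smulRight x
    - (ε * θ w * θ v / 2) • ad x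
    - (ε * θ w / 2) • θ.smulRight ⁅v, x⁆, fun u => ?_, ?_⟩
  · rw [lieCurv_christoffel hxx]
    simp only [LinearMap.add_apply, LinearMap.sub_apply, LinearMap.smul_apply,
      LinearMap.smulRight_apply, LinearMap.comp_apply, had, LieAlgebra.ad_apply, ← hθ]
    rw [← lie_skew ⁅u, v⁆ w, ← lie_skew u v, ← lie_skew u w, ← lie_skew u x]
    simp only [map_neg, lie_neg]
    module
  · simp only [map_add, map_sub, map_smul, LinearMap.trace_smulRight, LinearMap.comp_apply, had,
      LieAlgebra.ad_apply, trace_ad_comp_ad, trace_ad_of_isNilpotent hx, smul_eq_mul]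
    simp only [hxx]
    simp only [hθ, negKilling_lie_self, negKilling_comm w v]
    ring

/-- The trace `R_{ijp}^p` of the curvature of `christoffel ε x` vanishes. -/
theorem exists_trace_lieCurv_eq_faraday (hx : IsNilpotent (LieAlgebra.ad ℝ L x)) (ε : ℝ) (u v : L) :
    ∃ A : L →ₗ[ℝ] L, (∀ w, lieCurv (fun u v => christoffel ε x u v) u v w = A w) ∧
      LinearMap.trace ℝ L A = 0 := by
  have hxx := negKilling_self_of_isNilpotent_ad hx
  set θ := negKilling L x with hθ
  set ad := LieAlgebra.ad ℝ L with had
  refine ⟨(-(1 / 4) : ℝ) • ad ⁅u, v⁆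
    + (ε * θ u / 2) • (θ ∘ₗ ad v).smulRight x
    - (ε * θ v / 2) • (θ ∘ₗ ad u).smulRight x
    - (ε * θ ⁅u, v⁆) • θ.smulRight x
    + (ε * θ v / 2) • θ.smulRight ⁅u, x⁆
    - (ε * θ u / 2) • θ.smulRight ⁅v, x⁆, fun w => ?_, ?_⟩
  · rw [lieCurv_christoffel hxx]
    simp only [LinearMap.add_apply, LinearMap.sub_apply, LinearMap.smul_apply,
      LinearMap.smulRight_apply, LinearMap.comp_apply, had, LieAlgebra.ad_apply, ← hθ]
    module
  · simp only [map_add, map_sub, map_smul, LinearMap.trace_smulRight, LinearMap.comp_apply, had,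
      LieAlgebra.ad_apply, trace_ad_lie, smul_eq_mul]
    simp only [hxx]
    simp only [hθ, negKilling_lie_self]
    ring

/-- The trace `R_{ip}^p_j` of the curvature of `christoffel ε x` is `h / 4`. -/
theorem exists_trace_lieCurv_eq_ricciQ (hx : IsNilpotent (LieAlgebra.ad ℝ L x)) (ε : ℝ) (u v : L) :
    ∃ A : L →ₗ[ℝ] L, (∀ a b, negKilling L (lieCurv (fun u v => christoffel ε x u v) u a b) v =
        negKilling L (A a) b) ∧
      LinearMap.trace ℝ L A = negKilling L u v / 4 := by
  have hxx := negKilling_self_of_isNilpotent_ad hx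
  set θ := negKilling L x with hθ
  set ad := LieAlgebra.ad ℝ L with had
  refine ⟨(-(1 / 4) : ℝ) • ad v ∘ₗ ad u
    + (ε * θ u * θ v / 2) • ad x
    - (ε * θ v / 2) • θ.smulRight ⁅x, u⁆
    - (ε * θ v) • (θ ∘ₗ ad u).smulRight x
    + (ε * negKilling L ⁅u, x⁆ v / 2) • θ.smulRight x
    - (ε * θ u / 2) • (negKilling L ⁅x, v⁆).smulRight x, fun a b => ?_, ?_⟩
  · rw [lieCurv_christoffel hxx]
    simp only [LinearMap.add_apply, LinearMap.sub_apply, LinearMap.smul_apply,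
      LinearMap.smulRight_apply, LinearMap.comp_apply, had, LieAlgebra.ad_apply, ← hθ, map_add,
      map_sub, map_smul, smul_eq_mul]
    have h1 : negKilling L ⁅⁅u, a⁆, b⁆ v = negKilling L ⁅v, ⁅u, a⁆⁆ b := by
      rw [negKilling_lie, ← lie_skew v, map_neg, LinearMap.neg_apply, negKilling_lie _ v b,
        ← lie_skew v b, map_neg, neg_neg]
    have h2 : negKilling L ⁅a, x⁆ v = negKilling L ⁅x, v⁆ a := by
      rw [negKilling_lie, negKilling_comm]
    rw [h1, h2, negKilling_lie x a b, negKilling_lie x u b]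
    simp only [← hθ]
    ring
  · simp only [map_add, map_sub, map_smul, LinearMap.trace_smulRight, LinearMap.comp_apply, had,
      LieAlgebra.ad_apply, trace_ad_comp_ad, trace_ad_of_isNilpotent hx, smul_eq_mul]
    simp only [hxx]
    rw [negKilling_comm ⁅x, v⁆ x]
    simp only [hθ, negKilling_lie_self, negKilling_self_lie, negKilling_comm v u]
    ring

/-- A flat connection with one-form `σ` of difference from `Γ` gives a bilinear form `P`, namely
`∇σ - σ ⊗ σ`, which annihilates the curvature as in the hypothesis. Tracing determines `P` as a
multiple of `h`, and then the part of the curvature linear in `ε` remains. -/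
theorem false_of_lieCurv_add_eq_zero [LieAlgebra.IsKilling ℝ L]
    (hx : IsNilpotent (LieAlgebra.ad ℝ L x)) (hx0 : x ≠ 0) {ε : ℝ} (hε : ε ≠ 0)
    (P : L →ₗ[ℝ] L →ₗ[ℝ] ℝ)
    (hP : ∀ a b c, lieCurv (fun u v => christoffel ε x u v) a b c + (P a b - P b a) • c
      + P a c • b - P b c • a = 0) : False := by
  have hxx := negKilling_self_of_isNilpotent_ad hx
  set n : ℝ := (Module.finrank ℝ L : ℝ) with hn
  have hRic : ∀ v w, negKilling L v w / 4 + P w v = n * P v w := by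
    intro v w
    obtain ⟨A, hA, htr⟩ := exists_trace_lieCurv_eq_ricci hx ε v w
    have h0 : A + (P.flip v - P v).smulRight w + (P.flip w).smulRight v
        - P v w • LinearMap.id = 0 := by
      ext u
      have := hP u v w
      rw [hA] at this
      simpa using this
    have := congrArg (LinearMap.trace ℝ L) h0
    simp only [map_add, map_sub, map_smul, LinearMap.trace_smulRight, htr, LinearMap.sub_apply,
      LinearMap.flip_apply, LinearMap.trace_id, map_zero, smul_eq_mul, ← hn] at this
    linarith
  have hn0 : 0 ≤ n := Nat.cast_nonneg _
  have hsymm : ∀ v w, P v w = P w v := by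
    intro v w
    have h1 := hRic v w
    have h2 := hRic w v
    rw [negKilling_comm w v] at h2
    have : (n + 1) * (P v w - P w v) = 0 := by linear_combination h2 - h1
    rcases mul_eq_zero.1 this with h | h
    · linarith
    · linarith
  have hP' : ∀ v w, (n - 1) * P v w = negKilling L v w / 4 := by
    intro v w
    have h1 := hRic v w
    rw [hsymm w v] at h1
    linarith
  obtain ⟨c, a, hc, hac⟩ := exists_negKilling_ne_zero_and_lie_ne_zero (x := x) hx0
  have hn1 : n - 1 ≠ 0 := by
    intro h
    have := hP' x c
    rw [h] at this
    exact hc (by linarith)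
  have key := congrArg (fun u => negKilling L u c) (hP a c c)
  simp only [lieCurv_christoffel hxx, map_add, map_sub, map_smul, LinearMap.add_apply,
    LinearMap.sub_apply, LinearMap.smul_apply, smul_eq_mul, map_zero, LinearMap.zero_apply,
    lie_self, mul_zero, zero_sub, hsymm c a, sub_self, zero_mul, add_zero] at key
  have e1 : negKilling L ⁅⁅a, c⁆, c⁆ c = 0 := by
    rw [negKilling_lie, lie_self, map_zero]
  have e2 : negKilling L ⁅c, x⁆ c = 0 := by
    rw [negKilling_comm, negKilling_self_lie]
  have e3 : negKilling L ⁅a, x⁆ c = -negKilling L x ⁅a, c⁆ := by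
    rw [← lie_skew, map_neg, LinearMap.neg_apply, negKilling_lie]
  rw [e1, e2, e3] at key
  have h4 : (n - 1) * (ε * negKilling L x c ^ 2 * negKilling L x ⁅a, c⁆) = 0 := by
    have h1 := hP' a c
    have h2 := hP' c c
    linear_combination (-(n - 1) / 2) * key + (negKilling L c c / 2) * h1
      - (negKilling L a c / 2) * h2
  simp [hn1, hε, hc, hac] at h4

/-- The trace in the first and last indices of `cubicWeyl` vanishes, so that passing to the
trace-free part in the definition of the anti-self-conjugate Weyl tensor changes nothing. -/
theorem exists_trace_cubicWeyl (hx : IsNilpotent (LieAlgebra.ad ℝ L x)) (ε : ℝ) (b c : L) :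
    ∃ A : L →ₗ[ℝ] L, (∀ p q, cubicWeyl ε x p b c q = negKilling L (A p) q) ∧
      LinearMap.trace ℝ L A = 0 := by
  have hxx := negKilling_self_of_isNilpotent_ad hx
  set θ := negKilling L x with hθ
  set ad := LieAlgebra.ad ℝ L with had
  refine ⟨(ε * θ c) • (θ ∘ₗ ad b).smulRight x
    + (ε / 2 * θ b) • (θ ∘ₗ ad c).smulRight x
    - (ε / 2 * θ b * θ c) • ad x
    + (ε / 2 * θ ⁅b, c⁆) • θ.smulRight x
    + (ε / 2 * θ c) • θ.smulRight ⁅x, b⁆, fun p q => ?_, ?_⟩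
  · simp only [LinearMap.add_apply, LinearMap.sub_apply, LinearMap.smul_apply,
      LinearMap.smulRight_apply, LinearMap.comp_apply, had, LieAlgebra.ad_apply, ← hθ, map_add,
      map_sub, map_smul, smul_eq_mul, cubicWeyl]
    rw [negKilling_lie x p q, negKilling_lie x b q, ← lie_skew p b, ← lie_skew p c]
    simp only [← hθ, map_neg]
    ring
  · simp only [map_add, map_sub, map_smul, LinearMap.trace_smulRight, LinearMap.comp_apply, had,
      LieAlgebra.ad_apply, trace_ad_of_isNilpotent hx, smul_eq_mul]
    simp only [hxx]
    simp only [hθ, negKilling_lie_self, negKilling_self_lie]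
    ring

end KillingCubic

/-! ### Left trivialization of the tangent bundle -/

section LeftTrivialization

open Bundle

variable {E : Type*} [NormedAddCommGroup E] [NormedSpace ℝ E]
  {G : Type*} [TopologicalSpace G] [ChartedSpace E G] [Group G]

variable (E G) in
/-- The identification of the Lie algebra with the model space `E`. The former carries no norm, so
calculus on functions with values in the Lie algebra takes place in `E`. -/
def lieCoord : GroupLieAlgebra 𝓘(ℝ, E) G ≃L[ℝ] E :=
  (ContinuousLinearEquiv.refl ℝ E : E ≃L[ℝ] E)

variable [LieGroup 𝓘(ℝ, E) ∞ G]

/-- The chain rule for a composition of two left translations. The intermediate and final points are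
variables, so that they can be given in any form. -/
theorem mfderiv_mul_left_mul_left {g h k x y : G} (hk : g * h = k) (hy : h * x = y)
    (u : TangentSpace 𝓘(ℝ, E) x) :
    (mfderiv 𝓘(ℝ, E) 𝓘(ℝ, E) (g * ·) y : E → E)
      ((mfderiv 𝓘(ℝ, E) 𝓘(ℝ, E) (h * ·) x : E → E) u) =
      (mfderiv 𝓘(ℝ, E) 𝓘(ℝ, E) (k * ·) x : E → E) u := by
  subst hk hy
  have e : (fun y : G => g * h * y) = (g * ·) ∘ (h * ·) := by
    ext y; simp [mul_assoc]
  have hd : ∀ a b : G, MDiffAt (a * · : G → G) b := fun a b =>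
    (contMDiff_mul_left (I := 𝓘(ℝ, E)) (n := ∞)).contMDiffAt.mdifferentiableAt (by simp)
  rw [e, mfderiv_comp (I' := 𝓘(ℝ, E)) x (hd _ _) (hd _ _)]
  rfl

omit [LieGroup 𝓘(ℝ, E) ∞ G] in
theorem mfderiv_one_mul {k : G} (hk : k = 1) (x : G) (u : TangentSpace 𝓘(ℝ, E) x) :
    (mfderiv 𝓘(ℝ, E) 𝓘(ℝ, E) (k * ·) x : E → E) u = u := by
  subst hk
  have e : (fun y : G => 1 * y) = id := by
    ext y; simp
  rw [e, mfderiv_id]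
  rfl

/-- The left trivialization of the tangent bundle of a Lie group. -/
def leftTriv (g : G) : TangentSpace 𝓘(ℝ, E) g ≃L[ℝ] GroupLieAlgebra 𝓘(ℝ, E) G :=
  ContinuousLinearEquiv.equivOfInverse
    (show TangentSpace 𝓘(ℝ, E) g →L[ℝ] E from mfderiv 𝓘(ℝ, E) 𝓘(ℝ, E) (g⁻¹ * ·) g)
    (show E →L[ℝ] TangentSpace 𝓘(ℝ, E) g from mfderiv 𝓘(ℝ, E) 𝓘(ℝ, E) (g * ·) (1 : G))
    (fun u => (mfderiv_mul_left_mul_left (mul_inv_cancel g) (inv_mul_cancel g) u).trans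
      (mfderiv_one_mul rfl g u))
    (fun v => (mfderiv_mul_left_mul_left (inv_mul_cancel g) (mul_one g) v).trans
      (mfderiv_one_mul rfl 1 v))

theorem leftTriv_symm_apply (g : G) (a : GroupLieAlgebra 𝓘(ℝ, E) G) :
    (leftTriv g).symm a = mulInvariantVectorField a g := rfl

theorem leftTriv_mulInvariantVectorField (g : G) (a : GroupLieAlgebra 𝓘(ℝ, E) G) :
    leftTriv g (mulInvariantVectorField a g) = a := by
  rw [← leftTriv_symm_apply, ContinuousLinearEquiv.apply_symm_apply]

/-- The differential of a left translation is the identity in the left trivialization. -/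
theorem leftTriv_mfderiv_mul_left (g x : G) (u : TangentSpace 𝓘(ℝ, E) x) :
    leftTriv (g * x) (mfderiv 𝓘(ℝ, E) 𝓘(ℝ, E) (g * ·) x u) = leftTriv x u :=
  mfderiv_mul_left_mul_left (by group) rfl u

/-- Left translation by a variable point, applied to a variable tangent vector. -/
theorem contMDiff_mul_left_tangent {E' : Type*} [NormedAddCommGroup E'] [NormedSpace ℝ E']
    {H' : Type*} [TopologicalSpace H'] {I' : ModelWithCorners ℝ E' H'} {M : Type*}
    [TopologicalSpace M] [ChartedSpace H' M] {a : M → G} {W : M → TangentBundle 𝓘(ℝ, E) G}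
    (ha : ContMDiff I' 𝓘(ℝ, E) ∞ a) (hW : ContMDiff I' 𝓘(ℝ, E).tangent ∞ W) :
    ContMDiff I' 𝓘(ℝ, E).tangent ∞ (fun m => (TotalSpace.mk' E (a m * (W m).1)
      (mfderiv 𝓘(ℝ, E) 𝓘(ℝ, E) (a m * ·) (W m).1 (W m).2) : TangentBundle 𝓘(ℝ, E) G)) := by
  -- The differential of the multiplication `G × G → G` at `(0, W)`.
  have hz : ContMDiff I' 𝓘(ℝ, E).tangent ∞
      (fun m => (TotalSpace.mk' E (a m) 0 : TangentBundle 𝓘(ℝ, E) G)) :=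
    (contMDiff_zeroSection ℝ (TangentSpace 𝓘(ℝ, E) : G → Type _)).comp ha
  have h2 : ContMDiff (𝓘(ℝ, E).tangent.prod 𝓘(ℝ, E).tangent) (𝓘(ℝ, E).prod 𝓘(ℝ, E)).tangent ∞
      (equivTangentBundleProd 𝓘(ℝ, E) G 𝓘(ℝ, E) G).symm := contMDiff_equivTangentBundleProd_symm
  have h3 : ContMDiff (𝓘(ℝ, E).prod 𝓘(ℝ, E)).tangent 𝓘(ℝ, E).tangent ∞
      (tangentMap (𝓘(ℝ, E).prod 𝓘(ℝ, E)) 𝓘(ℝ, E) (fun (p : G × G) ↦ p.1 * p.2)) :=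
    ContMDiff.contMDiff_tangentMap (contMDiff_mul 𝓘(ℝ, E) ∞) (m := ∞) le_rfl
  have h := (h3.comp h2).comp (hz.prodMk hW)
  refine h.congr fun m => ?_
  simp only [Function.comp_apply, tangentMap]
  rw [mfderiv_prod_eq_add_apply ((contMDiff_mul 𝓘(ℝ, E) ∞).mdifferentiableAt (by simp))]
  refine congrArg (TotalSpace.mk' E (a m * (W m).1)) ?_
  symm
  erw [map_zero, zero_add]
  rfl

theorem contMDiff_mulInvariantVectorField_infty (v : GroupLieAlgebra 𝓘(ℝ, E) G) :
    CMDiff ∞ (T% (mulInvariantVectorField v : VField E G)) := by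
  have h := contMDiff_mul_left_tangent (E := E) (G := G) (I' := 𝓘(ℝ, E)) (a := id)
    (W := fun _ => TotalSpace.mk' E 1 v) contMDiff_id contMDiff_const
  convert h using 2 with g
  exact TotalSpace.ext (mul_one g).symm HEq.rfl

theorem trivializationAt_self {b b' : G} (hb : b' = b)
    (v : TangentSpace 𝓘(ℝ, E) b') :
    (trivializationAt E (TangentSpace 𝓘(ℝ, E)) b (TotalSpace.mk' E b' v)).2 = (v : E) := by
  subst hb
  exact congrArg Prod.snd (VectorBundleCore.localTrivAt_apply_mk (tangentBundleCore 𝓘(ℝ, E) G) b' v)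

/-- The left trivialization is smooth as a map on the tangent bundle. -/
theorem contMDiff_leftTriv : ContMDiff 𝓘(ℝ, E).tangent 𝓘(ℝ, E) ∞
    (fun p : TangentBundle 𝓘(ℝ, E) G => lieCoord E G (leftTriv p.1 p.2)) := by
  intro p
  have hp : ContMDiff 𝓘(ℝ, E).tangent 𝓘(ℝ, E) ∞
      (fun p : TangentBundle 𝓘(ℝ, E) G => p.1⁻¹) :=
    (contMDiff_inv 𝓘(ℝ, E) ∞).comp (contMDiff_proj _)
  have h := contMDiff_mul_left_tangent hp contMDiff_id p
  have h' := (contMDiffAt_totalSpace.1 h).2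
  refine h'.congr_of_eventuallyEq (Filter.Eventually.of_forall fun q => ?_)
  exact (trivializationAt_self (by simp) _).symm

/-- The components of a vector field in the left trivialization, as a function to `E`. -/
def leftCoord (Y : VField E G) (g : G) : E := lieCoord E G (leftTriv g (Y g))

theorem ContMDiffAt.leftCoord {Y : VField E G} {g : G} (hY : CMDiffAt ∞ (T% Y) g) :
    CMDiffAt ∞ (leftCoord Y) g :=
  (contMDiff_leftTriv _).comp g hY

theorem MDifferentiableAt.leftCoord {Y : VField E G} {g : G} (hY : MDiffAt (T% Y) g) :
    MDiffAt (leftCoord Y) g :=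
  ((contMDiff_leftTriv _).mdifferentiableAt (by simp)).comp g hY

theorem contMDiffAt_of_leftCoord [FiniteDimensional ℝ E] {Y : VField E G} {g : G}
    (hY : CMDiffAt ∞ (AH.leftCoord Y) g) : CMDiffAt ∞ (T% Y) g := by
  set b := Module.finBasis ℝ E with hb
  have hsum : Y = fun y => ∑ i,
      ((fun z => b.coord i (AH.leftCoord Y z)) •
        (mulInvariantVectorField ((lieCoord E G).symm (b i)) : VField E G)) y := by
    funext y
    apply (leftTriv y).injective
    apply (lieCoord E G).injective
    conv_lhs => rw [← b.sum_repr (lieCoord E G (leftTriv y (Y y)))]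
    simp [map_sum, leftTriv_mulInvariantVectorField, AH.leftCoord]
  rw [hsum]
  refine ContMDiffAt.sum_section fun i _ => ?_
  refine ContMDiffAt.smul_section ?_ (contMDiff_mulInvariantVectorField_infty _ g)
  exact (LinearMap.toContinuousLinearMap (b.coord i)).contDiff.contMDiff.contMDiffAt.comp g hY

theorem leftCoord_mulInvariantVectorField (a : GroupLieAlgebra 𝓘(ℝ, E) G) :
    leftCoord (mulInvariantVectorField a) = fun _ => lieCoord E G a := by
  funext g
  rw [AH.leftCoord, leftTriv_mulInvariantVectorField]

end LeftTrivialization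

/-! ### Derivatives of vector-valued functions along vector fields -/

section VectorValued

open Bundle

variable {E : Type*} [NormedAddCommGroup E] [NormedSpace ℝ E]
  {M : Type*} [TopologicalSpace M] [ChartedSpace E M]
  {F : Type*} [NormedAddCommGroup F] [NormedSpace ℝ F]
  {F' : Type*} [NormedAddCommGroup F'] [NormedSpace ℝ F']
  {F'' : Type*} [NormedAddCommGroup F''] [NormedSpace ℝ F'']

theorem mvfderiv_comp_hasFDerivAt {f : M → F} {Φ : F → F'} {Φ' : F →L[ℝ] F'} {x : M}
    (hf : MDiffAt f x) (hΦ : HasFDerivAt Φ Φ' (f x)) (u : TangentSpace 𝓘(ℝ, E) x) :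
    mvfderiv 𝓘(ℝ, E) (fun y => Φ (f y)) x u = Φ' (mvfderiv 𝓘(ℝ, E) f x u) :=
  congrArg (fun A : TangentSpace 𝓘(ℝ, E) x →L[ℝ] F' => A u)
    (hΦ.hasMFDerivAt.comp x hf.hasMFDerivAt).mfderiv

theorem mvfderiv_clm_comp {f : M → F} {x : M} (Φ : F →L[ℝ] F')
    (hf : MDiffAt f x) (u : TangentSpace 𝓘(ℝ, E) x) :
    mvfderiv 𝓘(ℝ, E) (fun y => Φ (f y)) x u = Φ (mvfderiv 𝓘(ℝ, E) f x u) :=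
  mvfderiv_comp_hasFDerivAt hf Φ.hasFDerivAt u

theorem mdifferentiableAt_bilin {f : M → F} {g : M → F'} {x : M} (B : F →L[ℝ] F' →L[ℝ] F'')
    (hf : MDiffAt f x) (hg : MDiffAt g x) : MDiffAt (fun y => B (f y) (g y)) x :=
  (B.differentiable.comp_mdifferentiableAt hf).clm_apply hg

theorem mvfderiv_bilin {f : M → F} {g : M → F'} {x : M} (B : F →L[ℝ] F' →L[ℝ] F'')
    (hf : MDiffAt f x) (hg : MDiffAt g x) (u : TangentSpace 𝓘(ℝ, E) x) :
    mvfderiv 𝓘(ℝ, E) (fun y => B (f y) (g y)) x u =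
      B (mvfderiv 𝓘(ℝ, E) f x u) (g x) + B (f x) (mvfderiv 𝓘(ℝ, E) g x u) := by
  have hB : HasFDerivAt (fun p : F × F' => B p.1 p.2) _ (f x, g x) :=
    B.hasFDerivAt_of_bilinear (hasFDerivAt_fst (𝕜 := ℝ) (p := (f x, g x)))
      (hasFDerivAt_snd (𝕜 := ℝ) (p := (f x, g x)))
  have h := mvfderiv_comp_hasFDerivAt (f := fun y => (f y, g y)) (hf.prodMk_space hg) hB u
  have h2 : mvfderiv 𝓘(ℝ, E) (fun y => (f y, g y)) x u =
      (mvfderiv 𝓘(ℝ, E) f x u, mvfderiv 𝓘(ℝ, E) g x u) :=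
    Prod.ext (mvfderiv_clm_comp (ContinuousLinearMap.fst ℝ F F') (hf.prodMk_space hg) u).symm
      (mvfderiv_clm_comp (ContinuousLinearMap.snd ℝ F F') (hf.prodMk_space hg) u).symm
  rw [h, h2]
  simp [add_comm]

theorem eventually_mdifferentiableAt {E' : Type*} [NormedAddCommGroup E'] [NormedSpace ℝ E']
    {H' : Type*} [TopologicalSpace H'] {I' : ModelWithCorners ℝ E' H'} {M' : Type*}
    [TopologicalSpace M'] [ChartedSpace H' M'] [IsManifold 𝓘(ℝ, E) ∞ M] [IsManifold I' ∞ M']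
    {f : M → M'} {x : M} (hf : ContMDiffAt 𝓘(ℝ, E) I' ∞ f x) :
    ∀ᶠ y in nhds x, MDifferentiableAt 𝓘(ℝ, E) I' f y := by
  have h1 : ContMDiffAt 𝓘(ℝ, E) I' 1 f x := hf.of_le (by simp)
  exact ((contMDiffAt_iff_contMDiffAt_nhds (by simp)).1 h1).mono
    fun y hy => hy.mdifferentiableAt (by simp)

theorem mvfderiv_congr_of_eventuallyEq {f g : M → F} {x : M} (h : f =ᶠ[nhds x] g) :
    mvfderiv 𝓘(ℝ, E) f x = mvfderiv 𝓘(ℝ, E) g x := by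
  have := h.mfderiv_eq (I := 𝓘(ℝ, E)) (I' := 𝓘(ℝ, F))
  exact this

variable [IsManifold 𝓘(ℝ, E) ∞ M]

/-- The derivative `Y f` of a smooth function along a smooth vector field is smooth. -/
theorem contMDiffAt_mvfderiv_apply {f : M → F} {Y : VField E M} {x : M} (hf : CMDiffAt ∞ f x)
    (hY : CMDiffAt ∞ (T% Y) x) :
    CMDiffAt ∞ (fun y => mvfderiv 𝓘(ℝ, E) f y (Y y)) x := by
  have h1 := hf.mfderiv_const (m := ∞) le_rfl
  have h2 := ContMDiffAt.clm_apply_of_inCoordinates (b₁ := fun y : M => y) (b₂ := f)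
    (ϕ := fun y => mfderiv 𝓘(ℝ, E) 𝓘(ℝ, F) f y) (v := fun y => Y y) (n := ∞) (F₁ := E) (F₂ := F)
    (E₁ := TangentSpace 𝓘(ℝ, E)) (E₂ := TangentSpace 𝓘(ℝ, F)) h1 hY hf
  exact (contMDiff_snd_tangentBundle_modelSpace F 𝓘(ℝ, F)).contMDiffAt.comp x h2

end VectorValued

section BracketDerivation

variable {E : Type*} [NormedAddCommGroup E] [NormedSpace ℝ E] [FiniteDimensional ℝ E]
  {M : Type*} [TopologicalSpace M] [ChartedSpace E M] [IsManifold 𝓘(ℝ, E) ∞ M]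
  {F : Type*} [NormedAddCommGroup F] [NormedSpace ℝ F] [FiniteDimensional ℝ F]

open VectorField

/-- The Lie bracket acts on functions as the commutator. This follows from the Jacobi identity for
`X`, `Y` and `f Z` at a point where `Z` does not vanish. -/
theorem mvfderiv_mlieBracket_real {f : M → ℝ} {X Y : VField E M} {x : M} (hf : CMDiffAt ∞ f x)
    (hX : CMDiffAt ∞ (T% X) x) (hY : CMDiffAt ∞ (T% Y) x) :
    mvfderiv 𝓘(ℝ, E) f x (mlieBracket 𝓘(ℝ, E) X Y x) =
      mvfderiv 𝓘(ℝ, E) (fun y => mvfderiv 𝓘(ℝ, E) f y (Y y)) x (X x)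
        - mvfderiv 𝓘(ℝ, E) (fun y => mvfderiv 𝓘(ℝ, E) f y (X y)) x (Y x) := by
  by_cases hE : ∀ z : TangentSpace 𝓘(ℝ, E) x, z = 0
  · rw [hE (X x), hE (Y x), hE (mlieBracket 𝓘(ℝ, E) X Y x)]
    simp
  push Not at hE
  obtain ⟨z, hz⟩ := hE
  set Z : VField E M := ext z with hZdef
  have hZ : CMDiffAt ∞ (T% Z) x := FiberBundle.contMDiffAt_extend _ _ _
  have hZx : Z x = z := FiberBundle.extend_apply_self _ _
  have hmin : minSmoothness ℝ (((⊤ : ℕ∞) : WithTop ℕ∞) + 1) ≤ ((⊤ : ℕ∞) : WithTop ℕ∞) := by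
    rw [minSmoothness_of_isRCLikeNormedField]; rfl
  have i3 : IsManifold 𝓘(ℝ, E) (minSmoothness ℝ 3) M := by
    rw [minSmoothness_of_isRCLikeNormedField]; infer_instance
  have i2 : IsManifold 𝓘(ℝ, E) (((⊤ : ℕ∞) : WithTop ℕ∞) + 1) M :=
    inferInstanceAs (IsManifold 𝓘(ℝ, E) ∞ M)
  have hbr : ∀ {V W : VField E M}, CMDiffAt ∞ (T% V) x → CMDiffAt ∞ (T% W) x →
      CMDiffAt ∞ (T% (mlieBracket 𝓘(ℝ, E) V W)) x := fun hV hW =>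
    hV.mlieBracket_vectorField hW (m := ⊤) (n := ⊤) hmin
  have hd : ∀ {V : VField E M}, CMDiffAt ∞ (T% V) x → MDiffAt (T% V) x := fun h =>
    h.mdifferentiableAt (by simp)
  have hdf := hf.mdifferentiableAt (by simp : (∞ : WithTop ℕ∞) ≠ 0)
  -- `[V, [W, f Z]]` for smooth `V` and `W`
  have key : ∀ {V W : VField E M}, CMDiffAt ∞ (T% V) x → CMDiffAt ∞ (T% W) x →
      mlieBracket 𝓘(ℝ, E) V (mlieBracket 𝓘(ℝ, E) W (f • Z)) x =
        mvfderiv 𝓘(ℝ, E) (fun y => mvfderiv 𝓘(ℝ, E) f y (W y)) x (V x) • Z x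
        + mvfderiv 𝓘(ℝ, E) f x (W x) • mlieBracket 𝓘(ℝ, E) V Z x
        + mvfderiv 𝓘(ℝ, E) f x (V x) • mlieBracket 𝓘(ℝ, E) W Z x
        + f x • mlieBracket 𝓘(ℝ, E) V (mlieBracket 𝓘(ℝ, E) W Z) x := by
    intro V W hV hW
    have e : mlieBracket 𝓘(ℝ, E) W (f • Z) =ᶠ[nhds x]
        (fun y => mvfderiv 𝓘(ℝ, E) f y (W y)) • Z + f • mlieBracket 𝓘(ℝ, E) W Z := by
      filter_upwards [eventually_mdifferentiableAt hf, eventually_mdifferentiableAt hZ] with y h1 h2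
      exact mlieBracket_smul_right h1 h2
    have hWf := contMDiffAt_mvfderiv_apply hf hW
    rw [(Filter.EventuallyEq.refl _ V).mlieBracket_vectorField_eq e,
      mlieBracket_add_right (hd (hWf.smul_section hZ)) (hd (hf.smul_section (hbr hW hZ))),
      mlieBracket_smul_right (hWf.mdifferentiableAt (by simp)) (hd hZ),
      mlieBracket_smul_right hdf (hd (hbr hW hZ))]
    module
  have h2 : ∀ {V : VField E M}, CMDiffAt ∞ (T% V) x → CMDiffAt (minSmoothness ℝ 2) (T% V) x :=
    fun h => by
      rw [minSmoothness_of_isRCLikeNormedField]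
      exact h.of_le ENat.LEInfty.out
  have J1 := leibniz_identity_mlieBracket_apply (h2 hX) (h2 hY) (h2 (hf.smul_section hZ))
  have J2 := leibniz_identity_mlieBracket_apply (h2 hX) (h2 hY) (h2 hZ)
  rw [key hX hY, key hY hX, mlieBracket_smul_right hdf (hd hZ), J2] at J1
  have : (mvfderiv 𝓘(ℝ, E) f x (mlieBracket 𝓘(ℝ, E) X Y x) -
      (mvfderiv 𝓘(ℝ, E) (fun y => mvfderiv 𝓘(ℝ, E) f y (Y y)) x (X x)
        - mvfderiv 𝓘(ℝ, E) (fun y => mvfderiv 𝓘(ℝ, E) f y (X y)) x (Y x))) • Z x = 0 := by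
    rw [← sub_eq_zero] at J1
    rw [← neg_eq_zero, ← J1]
    module
  rw [hZx] at this
  exact sub_eq_zero.1 ((smul_eq_zero.1 this).resolve_right hz)

theorem mvfderiv_mlieBracket {f : M → F} {X Y : VField E M} {x : M} (hf : CMDiffAt ∞ f x)
    (hX : CMDiffAt ∞ (T% X) x) (hY : CMDiffAt ∞ (T% Y) x) :
    mvfderiv 𝓘(ℝ, E) f x (mlieBracket 𝓘(ℝ, E) X Y x) =
      mvfderiv 𝓘(ℝ, E) (fun y => mvfderiv 𝓘(ℝ, E) f y (Y y)) x (X x)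
        - mvfderiv 𝓘(ℝ, E) (fun y => mvfderiv 𝓘(ℝ, E) f y (X y)) x (Y x) := by
  refine (Module.finBasis ℝ F).ext_elem fun i => ?_
  set ℓ : F →L[ℝ] ℝ := LinearMap.toContinuousLinearMap ((Module.finBasis ℝ F).coord i) with hℓ
  have hd : ∀ {g : M → F}, CMDiffAt ∞ g x → MDiffAt g x := fun h => h.mdifferentiableAt (by simp)
  have hev : ∀ᶠ y in nhds x, MDiffAt f y := eventually_mdifferentiableAt hf
  have h2 : ∀ Z : VField E M, (fun y => mvfderiv 𝓘(ℝ, E) (fun z => ℓ (f z)) y (Z y)) =ᶠ[nhds x]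
      fun y => ℓ (mvfderiv 𝓘(ℝ, E) f y (Z y)) := fun Z =>
    hev.mono fun y hy => mvfderiv_clm_comp ℓ hy (Z y)
  have h := mvfderiv_mlieBracket_real (f := fun y => ℓ (f y))
    (ℓ.contDiff.contMDiff.contMDiffAt.comp x hf) hX hY
  rw [mvfderiv_congr_of_eventuallyEq (h2 X), mvfderiv_congr_of_eventuallyEq (h2 Y),
    mvfderiv_clm_comp ℓ (hd hf), mvfderiv_clm_comp ℓ (hd (contMDiffAt_mvfderiv_apply hf hX)),
    mvfderiv_clm_comp ℓ (hd (contMDiffAt_mvfderiv_apply hf hY)), ← map_sub] at h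
  exact h

end BracketDerivation

/-! ### Left-invariant connections -/

section LeftInvariantConnections

open VectorField

variable {E : Type*} [NormedAddCommGroup E] [NormedSpace ℝ E] [FiniteDimensional ℝ E]
  {G : Type*} [TopologicalSpace G] [ChartedSpace E G] [Group G]

instance : T2Space (GroupLieAlgebra 𝓘(ℝ, E) G) := inferInstanceAs (T2Space E)

/-- A bilinear map on the Lie algebra, transported to the model space. -/
def coordBilin (Γ : GroupLieAlgebra 𝓘(ℝ, E) G →ₗ[ℝ] GroupLieAlgebra 𝓘(ℝ, E) G →ₗ[ℝ]
    GroupLieAlgebra 𝓘(ℝ, E) G) : E →L[ℝ] E →L[ℝ] E :=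
  ((Γ.compl₁₂ (lieCoord E G).symm.toLinearEquiv.toLinearMap
    (lieCoord E G).symm.toLinearEquiv.toLinearMap).compr₂
      (lieCoord E G).toLinearEquiv.toLinearMap).toContinuousBilinearMap

theorem coordBilin_apply (Γ : GroupLieAlgebra 𝓘(ℝ, E) G →ₗ[ℝ] GroupLieAlgebra 𝓘(ℝ, E) G →ₗ[ℝ]
    GroupLieAlgebra 𝓘(ℝ, E) G) (u v : E) :
    coordBilin Γ u v = lieCoord E G (Γ ((lieCoord E G).symm u) ((lieCoord E G).symm v)) := rfl

variable [LieGroup 𝓘(ℝ, E) ∞ G]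

/-- The left-invariant connection with Christoffel symbol `Γ`: in the left trivialization,
`∇_u Y = dY(u) + Γ(u, Y)`. -/
def leftCov (Γ : GroupLieAlgebra 𝓘(ℝ, E) G →ₗ[ℝ] GroupLieAlgebra 𝓘(ℝ, E) G →ₗ[ℝ]
    GroupLieAlgebra 𝓘(ℝ, E) G) : CovOp E G := fun Y g =>
  (leftTriv g).symm.toContinuousLinearMap ∘L
    ((lieCoord E G).symm.toContinuousLinearMap ∘L mvfderiv 𝓘(ℝ, E) (leftCoord Y) g +
      (LinearMap.toContinuousLinearMap (Γ.flip (leftTriv g (Y g)))) ∘L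
        (leftTriv g).toContinuousLinearMap)

variable (Γ : GroupLieAlgebra 𝓘(ℝ, E) G →ₗ[ℝ] GroupLieAlgebra 𝓘(ℝ, E) G →ₗ[ℝ]
    GroupLieAlgebra 𝓘(ℝ, E) G)

theorem leftTriv_leftCov (Y : VField E G) (g : G) (u : TangentSpace 𝓘(ℝ, E) g) :
    leftTriv g (leftCov Γ Y g u) = (lieCoord E G).symm (mvfderiv 𝓘(ℝ, E) (leftCoord Y) g u) +
      Γ (leftTriv g u) (leftTriv g (Y g)) := by
  simp [leftCov]

theorem leftCoord_leftCov (X Y : VField E G) :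
    leftCoord (fun g => leftCov Γ Y g (X g)) = fun g => mvfderiv 𝓘(ℝ, E) (leftCoord Y) g (X g) +
      coordBilin Γ (leftCoord X g) (leftCoord Y g) := by
  funext g
  simp [leftCoord, leftTriv_leftCov, coordBilin_apply]

theorem leftTriv_leftCov_mulInvariantVectorField (a : GroupLieAlgebra 𝓘(ℝ, E) G) (g : G)
    (u : TangentSpace 𝓘(ℝ, E) g) :
    leftTriv g (leftCov Γ (mulInvariantVectorField a) g u) = Γ (leftTriv g u) a := by
  rw [leftTriv_leftCov, leftCoord_mulInvariantVectorField, leftTriv_mulInvariantVectorField,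
    mvfderiv_const]
  simp

theorem isCovariantDerivativeOn_leftCov : IsCovariantDerivativeOn E (leftCov Γ) Set.univ where
  add {σ σ' g} hσ hσ' _ := by
    ext u
    apply (leftTriv g).injective
    have e : leftCoord (σ + σ') = leftCoord σ + leftCoord σ' := by
      funext y
      simp [leftCoord]
    simp only [leftTriv_leftCov, add_apply, map_add, e,
      mvfderiv_add (MDifferentiableAt.leftCoord hσ) (MDifferentiableAt.leftCoord hσ'), Pi.add_apply]
    abel
  leibniz {σ f g} hσ hf _ := by
    ext u
    apply (leftTriv g).injective
    have e : leftCoord (f • σ) = f • leftCoord σ := by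
      funext y
      simp [leftCoord]
    simp only [leftTriv_leftCov, add_apply, smul_apply,
      ContinuousLinearMap.smulRight_apply, map_add, map_smul, e,
      mvfderiv_smul hf (MDifferentiableAt.leftCoord hσ), Pi.smul_apply', leftCoord,
      ContinuousLinearEquiv.symm_apply_apply, smul_add]
    abel

theorem mlieBracket_mulInvariantVectorField (a b : GroupLieAlgebra 𝓘(ℝ, E) G) (g : G) :
    mlieBracket 𝓘(ℝ, E) (mulInvariantVectorField a) (mulInvariantVectorField b) g =
      mulInvariantVectorField ⁅a, b⁆ g := by
  rw [GroupLieAlgebra.bracket_def, mulInvariantVector_mlieBracket]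

/-- The torsion is a tensor, so it can be computed on left-invariant fields. -/
theorem leftCov_sub_leftCov (hΓ : ∀ a b, Γ a b - Γ b a = ⁅a, b⁆) {X Y : VField E G} {g : G}
    (hX : MDiffAt (T% X) g) (hY : MDiffAt (T% Y) g) :
    leftCov Γ Y g (X g) - leftCov Γ X g (Y g) = mlieBracket 𝓘(ℝ, E) X Y g := by
  have hcov := isCovariantDerivativeOn_leftCov Γ
  have h1 := hcov.torsion_apply hX hY
  have hinv : ∀ u : TangentSpace 𝓘(ℝ, E) g,
      (mulInvariantVectorField (leftTriv g u) : VField E G) g = u := fun u => by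
    rw [← leftTriv_symm_apply, ContinuousLinearEquiv.symm_apply_apply]
  have hd : ∀ a : GroupLieAlgebra 𝓘(ℝ, E) G,
      MDiffAt (T% (mulInvariantVectorField a : VField E G)) g := fun a =>
    (contMDiff_mulInvariantVectorField_infty a g).mdifferentiableAt (by simp)
  have h2 := hcov.torsion_apply (hd (leftTriv g (X g))) (hd (leftTriv g (Y g)))
  rw [hinv, hinv, h1, mlieBracket_mulInvariantVectorField] at h2
  rw [← sub_eq_zero, h2]
  apply (leftTriv g).injective
  simp only [map_sub, map_zero, leftTriv_leftCov_mulInvariantVectorField,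
    leftTriv_mulInvariantVectorField, hΓ, sub_self]

theorem isTorsionFreeConnectionOn_leftCov (hΓ : ∀ a b, Γ a b - Γ b a = ⁅a, b⁆) :
    IsTorsionFreeConnectionOn (leftCov Γ) Set.univ where
  isCovariantDerivativeOn := isCovariantDerivativeOn_leftCov Γ
  smooth X Y g _ hX hY := by
    apply contMDiffAt_of_leftCoord
    rw [leftCoord_leftCov]
    have hX' := ContMDiffAt.leftCoord hX
    have hY' := ContMDiffAt.leftCoord hY
    exact (contMDiffAt_mvfderiv_apply hY' hX).add
      (((coordBilin Γ).contDiff.contMDiff.contMDiffAt.comp g hX').clm_apply hY')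
  torsion_free X Y g _ hX hY := leftCov_sub_leftCov Γ hΓ hX hY

/-- The curvature of a left-invariant connection, for arbitrary smooth vector fields. -/
theorem leftTriv_curvatureField_leftCov (hΓ : ∀ a b, Γ a b - Γ b a = ⁅a, b⁆) {X Y Z : VField E G}
    {g : G} (hX : CMDiffAt ∞ (T% X) g) (hY : CMDiffAt ∞ (T% Y) g) (hZ : CMDiffAt ∞ (T% Z) g) :
    leftTriv g (curvatureField (leftCov Γ) X Y Z g) =
      lieCurv (fun a b => Γ a b) (leftTriv g (X g)) (leftTriv g (Y g)) (leftTriv g (Z g)) := by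
  have hX' := ContMDiffAt.leftCoord hX
  have hY' := ContMDiffAt.leftCoord hY
  have hZ' := ContMDiffAt.leftCoord hZ
  have hd : ∀ {f : G → E}, CMDiffAt ∞ f g → MDiffAt f g := fun h => h.mdifferentiableAt (by simp)
  have key : ∀ {V W : VField E G}, CMDiffAt ∞ (T% V) g → CMDiffAt ∞ (T% W) g →
      leftTriv g (leftCov Γ (fun y => leftCov Γ Z y (W y)) g (V g)) =
      (lieCoord E G).symm
        (mvfderiv 𝓘(ℝ, E) (fun y => mvfderiv 𝓘(ℝ, E) (leftCoord Z) y (W y)) g (V g)) +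
      Γ ((lieCoord E G).symm (mvfderiv 𝓘(ℝ, E) (leftCoord W) g (V g))) (leftTriv g (Z g)) +
      Γ (leftTriv g (W g)) ((lieCoord E G).symm (mvfderiv 𝓘(ℝ, E) (leftCoord Z) g (V g))) +
      Γ (leftTriv g (V g)) ((lieCoord E G).symm (mvfderiv 𝓘(ℝ, E) (leftCoord Z) g (W g))) +
      Γ (leftTriv g (V g)) (Γ (leftTriv g (W g)) (leftTriv g (Z g))) := by
    intro V W hV hW
    have hW' := ContMDiffAt.leftCoord hW
    rw [leftTriv_leftCov, leftCoord_leftCov,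
      mvfderiv_fun_add (hd (contMDiffAt_mvfderiv_apply hZ' hW))
        (mdifferentiableAt_bilin _ (hd hW') (hd hZ')), add_apply,
      mvfderiv_bilin _ (hd hW') (hd hZ'), leftTriv_leftCov]
    simp only [coordBilin_apply, map_add, ContinuousLinearEquiv.symm_apply_apply, leftCoord]
    abel
  have hbr : leftTriv g (mlieBracket 𝓘(ℝ, E) X Y g) =
      (lieCoord E G).symm (mvfderiv 𝓘(ℝ, E) (leftCoord Y) g (X g)) -
      (lieCoord E G).symm (mvfderiv 𝓘(ℝ, E) (leftCoord X) g (Y g)) +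
      ⁅leftTriv g (X g), leftTriv g (Y g)⁆ := by
    rw [← leftCov_sub_leftCov Γ hΓ (hX.mdifferentiableAt (by simp))
      (hY.mdifferentiableAt (by simp)), map_sub, leftTriv_leftCov, leftTriv_leftCov, ← hΓ]
    abel
  unfold curvatureField
  rw [map_sub, map_sub, key hX hY, key hY hX, leftTriv_leftCov, mvfderiv_mlieBracket hZ' hX hY, hbr]
  simp only [map_add, map_sub, LinearMap.add_apply, LinearMap.sub_apply, lieCurv]
  abel

theorem curv_leftCov (hΓ : ∀ a b, Γ a b - Γ b a = ⁅a, b⁆) (g : G)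
    (u v w : TangentSpace 𝓘(ℝ, E) g) :
    curv (leftCov Γ) g u v w = (leftTriv g).symm
      (lieCurv (fun a b => Γ a b) (leftTriv g u) (leftTriv g v) (leftTriv g w)) := by
  rw [ContinuousLinearEquiv.eq_symm_apply]
  have hs : ∀ u : TangentSpace 𝓘(ℝ, E) g, CMDiffAt ∞ (T% (ext u : VField E G)) g := fun u =>
    FiberBundle.contMDiffAt_extend _ _ _
  have he : ∀ u : TangentSpace 𝓘(ℝ, E) g, (ext u : VField E G) g = u := fun u =>
    FiberBundle.extend_apply_self _ _
  have h := leftTriv_curvatureField_leftCov Γ hΓ (hs u) (hs v) (hs w)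
  rwa [he, he, he] at h

theorem leftInvariantConnection_leftCov : LeftInvariantConnection (leftCov Γ) := by
  intro k Y hY g u
  have hinv : ∀ y, leftTriv y (mpullback 𝓘(ℝ, E) 𝓘(ℝ, E) (k * ·) Y y) =
      leftTriv (k * y) (Y (k * y)) := by
    intro y
    rw [mpullback_apply, inverse_mfderiv_mul_left]
    exact mfderiv_mul_left_mul_left (by group) (by group) _
  have hcoord : leftCoord (mpullback 𝓘(ℝ, E) 𝓘(ℝ, E) (k * ·) Y) = leftCoord Y ∘ (k * ·) := by
    funext y
    simp [leftCoord, hinv]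
  apply (leftTriv (k * g)).injective
  rw [leftTriv_mfderiv_mul_left, leftTriv_leftCov, leftTriv_leftCov, leftTriv_mfderiv_mul_left,
    hinv, hcoord]
  congr 2
  have hk : MDiffAt (k * · : G → G) g :=
    (contMDiff_mul_left (I := 𝓘(ℝ, E)) (n := ∞)).contMDiffAt.mdifferentiableAt (by simp)
  exact mfderiv_comp_apply g (MDifferentiableAt.leftCoord (hY _)) hk u

end LeftInvariantConnections

/-! ### The Killing metric and its cubic deformation of the Levi-Civita connection -/

section KillingMetric

variable {E : Type*} [NormedAddCommGroup E] [NormedSpace ℝ E] {G : Type*} [TopologicalSpace G]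
  [ChartedSpace E G] [Group G]

theorem finrank_groupLieAlgebra : Module.finrank ℝ (GroupLieAlgebra 𝓘(ℝ, E) G) =
    Module.finrank ℝ E := rfl

variable [FiniteDimensional ℝ E]

theorem finrank_ne_zero_of_ne_zero {x : GroupLieAlgebra 𝓘(ℝ, E) G} (hx0 : x ≠ 0) :
    (Module.finrank ℝ E : ℝ) ≠ 0 := by
  have : Nontrivial E := ⟨⟨lieCoord E G x, 0, fun h => hx0 (by simpa using h)⟩⟩
  exact_mod_cast Module.finrank_pos.ne'

variable [LieGroup 𝓘(ℝ, E) ∞ G]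

instance (g : G) : T2Space (TangentSpace 𝓘(ℝ, E) g) := inferInstanceAs (T2Space E)

variable (E G) in
/-- The negative of the Killing form, transported to the model space. -/
def coordKilling : E →L[ℝ] E →L[ℝ] ℝ :=
  ((negKilling (GroupLieAlgebra 𝓘(ℝ, E) G)).compl₁₂ (lieCoord E G).symm.toLinearEquiv.toLinearMap
    (lieCoord E G).symm.toLinearEquiv.toLinearMap).toContinuousBilinearMap

theorem coordKilling_leftCoord (X Y : VField E G) (g : G) :
    coordKilling E G (leftCoord X g) (leftCoord Y g) =
      negKilling (GroupLieAlgebra 𝓘(ℝ, E) G) (leftTriv g (X g)) (leftTriv g (Y g)) := rfl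

/-- The negative of the Killing form on the tangent space at `g`, in the left trivialization. -/
def tangentKilling (g : G) :
    TangentSpace 𝓘(ℝ, E) g →L[ℝ] TangentSpace 𝓘(ℝ, E) g →L[ℝ] ℝ :=
  ((negKilling (GroupLieAlgebra 𝓘(ℝ, E) G)).compl₁₂ (leftTriv g).toLinearEquiv.toLinearMap
    (leftTriv g).toLinearEquiv.toLinearMap).toContinuousBilinearMap

theorem tangentKilling_apply (g : G) (u v : TangentSpace 𝓘(ℝ, E) g) :
    tangentKilling g u v =
      negKilling (GroupLieAlgebra 𝓘(ℝ, E) G) (leftTriv g u) (leftTriv g v) := rfl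

theorem contMDiffAt_tangentKilling {X Y : VField E G} {g : G} (hX : CMDiffAt ∞ (T% X) g)
    (hY : CMDiffAt ∞ (T% Y) g) : CMDiffAt ∞ (fun y => tangentKilling y (X y) (Y y)) g :=
  (ContMDiffAt.clm_apply
    ((coordKilling E G).contDiff.contMDiff.contMDiffAt.comp g (ContMDiffAt.leftCoord hX))
    (ContMDiffAt.leftCoord hY) :
    CMDiffAt ∞ (fun y => coordKilling E G (leftCoord X y) (leftCoord Y y)) g)

variable (E G) in
/-- The bi-invariant metric given by the negative of the Killing form. -/
def killingMetric [LieAlgebra.IsKilling ℝ (GroupLieAlgebra 𝓘(ℝ, E) G)] : PseudoMetric E G where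
  form := tangentKilling
  symm g u v := negKilling_comm (leftTriv g u) (leftTriv g v)
  nondegenerate g u hu := by
    apply (leftTriv g).injective
    rw [map_zero]
    refine negKilling_nondegenerate.1 _ fun w => ?_
    have h := hu ((leftTriv g).symm w)
    rwa [tangentKilling_apply, ContinuousLinearEquiv.apply_symm_apply] at h
  smooth _ _ _ hX hY := contMDiffAt_tangentKilling hX hY

theorem killingMetric_form [LieAlgebra.IsKilling ℝ (GroupLieAlgebra 𝓘(ℝ, E) G)] (g : G)
    (u v : TangentSpace 𝓘(ℝ, E) g) :
    (killingMetric E G).form g u v =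
      negKilling (GroupLieAlgebra 𝓘(ℝ, E) G) (leftTriv g u) (leftTriv g v) := rfl

variable {x : GroupLieAlgebra 𝓘(ℝ, E) G} {ε : ℝ} {f : G → ℝ} {h : PseudoMetric E G}

/-- The connection `D + ε h(x, ·) h(x, ·) x`, with `D` the Levi-Civita connection of the Killing
form. -/
abbrev killingCov (ε : ℝ) (x : GroupLieAlgebra 𝓘(ℝ, E) G) : CovOp E G := leftCov (christoffel ε x)

theorem curv_killingCov (g : G) (u v w : TangentSpace 𝓘(ℝ, E) g) :
    curv (killingCov ε x) g u v w = (leftTriv g).symm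
      (lieCurv (fun a b => christoffel ε x a b) (leftTriv g u) (leftTriv g v) (leftTriv g w)) :=
  curv_leftCov _ (christoffel_sub_swap ε x) g u v w

theorem ricci_killingCov (hx : IsNilpotent (LieAlgebra.ad ℝ (GroupLieAlgebra 𝓘(ℝ, E) G) x)) (g : G)
    (v w : TangentSpace 𝓘(ℝ, E) g) :
    ricci (killingCov ε x) g v w =
      negKilling (GroupLieAlgebra 𝓘(ℝ, E) G) (leftTriv g v) (leftTriv g w) / 4 := by
  obtain ⟨A, hA, htr⟩ := exists_trace_lieCurv_eq_ricci hx ε (leftTriv g v) (leftTriv g w)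
  rw [← htr]
  exact endoTrace_eq_trace_of_conj (leftTriv g).toLinearEquiv A fun u => by
    rw [curv_killingCov, hA]; rfl

theorem faraday_killingCov (hx : IsNilpotent (LieAlgebra.ad ℝ (GroupLieAlgebra 𝓘(ℝ, E) G) x)) :
    faraday (killingCov ε x) = fun _ _ _ => 0 := by
  funext g u v
  obtain ⟨A, hA, htr⟩ := exists_trace_lieCurv_eq_faraday hx ε (leftTriv g u) (leftTriv g v)
  have : endoTrace (fun w => curv (killingCov ε x) g u v w) = 0 := by
    rw [← htr]
    exact endoTrace_eq_trace_of_conj (leftTriv g).toLinearEquiv A fun w => by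
      rw [curv_killingCov, hA]; rfl
  rw [faraday, this, mul_zero]

/-- `∇(f h) = df ⊗ h - 2 ε f θ ⊗ θ ⊗ θ`, where `θ = h(x, ·)`. -/
theorem nablaMetric_killingCov
    (hh : ∀ y u v, h.form y u v =
      f y * negKilling (GroupLieAlgebra 𝓘(ℝ, E) G) (leftTriv y u) (leftTriv y v))
    {g : G} (hf : MDiffAt f g) (u v w : TangentSpace 𝓘(ℝ, E) g) :
    nablaMetric (killingCov ε x) h g v w u =
      mvfderiv 𝓘(ℝ, E) f g u *
        negKilling (GroupLieAlgebra 𝓘(ℝ, E) G) (leftTriv g v) (leftTriv g w) -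
      f g * (2 * ε * negKilling (GroupLieAlgebra 𝓘(ℝ, E) G) x (leftTriv g u) *
        negKilling (GroupLieAlgebra 𝓘(ℝ, E) G) x (leftTriv g v) *
        negKilling (GroupLieAlgebra 𝓘(ℝ, E) G) x (leftTriv g w)) := by
  have hs : ∀ u : TangentSpace 𝓘(ℝ, E) g, MDiffAt (leftCoord (ext u : VField E G)) g := fun u =>
    (ContMDiffAt.leftCoord (FiberBundle.contMDiffAt_extend _ _ _)).mdifferentiableAt
      (by simp : (∞ : WithTop ℕ∞) ≠ 0)
  have he : ∀ u : TangentSpace 𝓘(ℝ, E) g, (ext u : VField E G) g = u := fun u =>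
    FiberBundle.extend_apply_self _ _
  have e1 : (fun y => h.form y ((ext v : VField E G) y) ((ext w : VField E G) y)) =
      fun y => f y * coordKilling E G (leftCoord (ext v) y) (leftCoord (ext w) y) := by
    funext y
    rw [hh, coordKilling_leftCoord]
  have e2 := negKilling_christoffel_add ε x (leftTriv g u) (leftTriv g v)
    (leftTriv g w)
  have e3 : ∀ (a : E) (b : TangentSpace 𝓘(ℝ, E) g),
      coordKilling E G a (leftCoord (ext b) g) =
        negKilling (GroupLieAlgebra 𝓘(ℝ, E) G) ((lieCoord E G).symm a) (leftTriv g b) :=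
      fun a b => by
    conv_rhs => rw [← he b]
    rfl
  have e4 : ∀ (a : E) (b : TangentSpace 𝓘(ℝ, E) g),
      coordKilling E G (leftCoord (ext b) g) a =
        negKilling (GroupLieAlgebra 𝓘(ℝ, E) G) ((lieCoord E G).symm a) (leftTriv g b) :=
      fun a b => by
    rw [negKilling_comm]
    conv_rhs => rw [← he b]
    rfl
  have e5 : coordKilling E G (leftCoord (ext v) g) (leftCoord (ext w) g) =
      negKilling (GroupLieAlgebra 𝓘(ℝ, E) G) (leftTriv g v) (leftTriv g w) := by
    rw [coordKilling_leftCoord, he, he]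
  simp only [nablaMetric, e1, sub_apply, ContinuousLinearMap.comp_apply]
  rw [mvfderiv_fun_mul hf (mdifferentiableAt_bilin _ (hs v) (hs w))]
  simp only [add_apply, smul_apply, smul_eq_mul]
  rw [mvfderiv_bilin _ (hs v) (hs w), hh, hh, leftTriv_leftCov, leftTriv_leftCov, he, he, e3,
    e4, e5]
  simp only [map_add]
  rw [negKilling_comm (leftTriv g w) _, negKilling_comm (leftTriv g w) _]
  rw [negKilling_comm (leftTriv g v) ((lieCoord E G).symm _)]
  linear_combination (-f g) * e2

theorem conjugateCov_apply (cov : CovOp E G) (Y : VField E G) (g : G)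
    (u : TangentSpace 𝓘(ℝ, E) g) : conjugateCov cov h Y g u = cov Y g u +
      metricTrace (h.at g) (fun p q => nablaNormalized cov h g (Y g) p u • q) := by
  rw [conjugateCov, add_apply]
  congr 1
  simp only [metricTrace, sum_apply, smul_apply, ContinuousLinearMap.smulRight_apply]

variable [LieAlgebra.IsKilling ℝ (GroupLieAlgebra 𝓘(ℝ, E) G)]

/-- Metric traces for a metric conformal to the Killing form. -/
theorem metricTrace_at (hh : ∀ y u v, h.form y u v =
      f y * negKilling (GroupLieAlgebra 𝓘(ℝ, E) G) (leftTriv y u) (leftTriv y v))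
    {g : G} (hf : f g ≠ 0)
    (A : GroupLieAlgebra 𝓘(ℝ, E) G →ₗ[ℝ] GroupLieAlgebra 𝓘(ℝ, E) G)
    {T : TangentSpace 𝓘(ℝ, E) g → TangentSpace 𝓘(ℝ, E) g → ℝ}
    (hT : ∀ p q, T p q = negKilling (GroupLieAlgebra 𝓘(ℝ, E) G) (A (leftTriv g p)) (leftTriv g q)) :
    metricTrace (h.at g) T = (f g)⁻¹ * LinearMap.trace ℝ _ A :=
  metricTrace_eq_trace_of_pullback (H := h.at g)
    (β := negKilling (GroupLieAlgebra 𝓘(ℝ, E) G)) (f := f g) (leftTriv g).toLinearEquiv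
    negKilling_nondegenerate negKilling_comm hf A (fun u v => hh g u v) hT

theorem scal_killingCov (hx : IsNilpotent (LieAlgebra.ad ℝ (GroupLieAlgebra 𝓘(ℝ, E) G) x))
    (hh : ∀ y u v, h.form y u v =
      f y * negKilling (GroupLieAlgebra 𝓘(ℝ, E) G) (leftTriv y u) (leftTriv y v))
    {g : G} (hf : f g ≠ 0) :
    scal (killingCov ε x) h g = (Module.finrank ℝ E : ℝ) / 4 * (f g)⁻¹ := by
  have := metricTrace_at hh hf ((1 / 4 : ℝ) • LinearMap.id) (T := ricci (killingCov ε x) g)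
    fun p q => by rw [ricci_killingCov hx]; simp; ring
  rw [scal, this, map_smul, LinearMap.trace_id, finrank_groupLieAlgebra, smul_eq_mul]
  ring

theorem ricciQ_killingCov (hx : IsNilpotent (LieAlgebra.ad ℝ (GroupLieAlgebra 𝓘(ℝ, E) G) x))
    (hh : ∀ y u v, h.form y u v =
      f y * negKilling (GroupLieAlgebra 𝓘(ℝ, E) G) (leftTriv y u) (leftTriv y v))
    {g : G} (hf : f g ≠ 0) (u v : TangentSpace 𝓘(ℝ, E) g) :
    ricciQ (killingCov ε x) h g u v =
      negKilling (GroupLieAlgebra 𝓘(ℝ, E) G) (leftTriv g u) (leftTriv g v) / 4 := by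
  obtain ⟨A, hA, htr⟩ := exists_trace_lieCurv_eq_ricciQ hx ε (leftTriv g u) (leftTriv g v)
  have := metricTrace_at hh hf (f g • A)
    (T := fun a b => h.at g (curv (killingCov ε x) g u a b) v) fun p q => by
      rw [PseudoMetric.at, hh, curv_killingCov, ContinuousLinearEquiv.apply_symm_apply, hA]
      simp
  rw [ricciQ, this, map_smul, htr, smul_eq_mul, ← mul_assoc, inv_mul_cancel₀ hf, one_mul]

theorem metricTrace_nablaMetric_killingCov
    (hx : IsNilpotent (LieAlgebra.ad ℝ (GroupLieAlgebra 𝓘(ℝ, E) G) x))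
    (hh : ∀ y u v, h.form y u v =
      f y * negKilling (GroupLieAlgebra 𝓘(ℝ, E) G) (leftTriv y u) (leftTriv y v))
    {g : G} (hf : MDiffAt f g) (hf0 : f g ≠ 0) (u : TangentSpace 𝓘(ℝ, E) g) :
    metricTrace (h.at g) (fun p q => nablaMetric (killingCov ε x) h g p q u) =
      (f g)⁻¹ * (Module.finrank ℝ E * mvfderiv 𝓘(ℝ, E) f g u) := by
  rw [metricTrace_at hh hf0 (mvfderiv 𝓘(ℝ, E) f g u • LinearMap.id -
    (f g * (2 * ε * negKilling (GroupLieAlgebra 𝓘(ℝ, E) G) x (leftTriv g u))) •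
      (negKilling (GroupLieAlgebra 𝓘(ℝ, E) G) x).smulRight x) fun p q => by
      rw [nablaMetric_killingCov hh hf]
      simp only [LinearMap.sub_apply, LinearMap.smul_apply, LinearMap.smulRight_apply, map_sub,
        map_smul, smul_eq_mul, LinearMap.id_apply]
      ring]
  rw [map_sub, map_smul, map_smul, LinearMap.trace_id, LinearMap.trace_smulRight,
    negKilling_self_of_isNilpotent_ad hx, finrank_groupLieAlgebra, smul_zero, sub_zero, smul_eq_mul,
    mul_comm (mvfderiv 𝓘(ℝ, E) f g u)]

theorem aligned_killingCov (hx : IsNilpotent (LieAlgebra.ad ℝ (GroupLieAlgebra 𝓘(ℝ, E) G) x))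
    (hh : ∀ y u v, h.form y u v =
      f y * negKilling (GroupLieAlgebra 𝓘(ℝ, E) G) (leftTriv y u) (leftTriv y v))
    (hf : MDiff f) (hf0 : ∀ g, f g ≠ 0) : Aligned (killingCov ε x) h := by
  intro g u
  rw [metricTrace_nablaMetric_killingCov hx hh (hf g) (hf0 g)]
  set df : GroupLieAlgebra 𝓘(ℝ, E) G →ₗ[ℝ] ℝ :=
    (mvfderiv 𝓘(ℝ, E) f g).toLinearMap ∘ₗ (leftTriv g).symm.toLinearEquiv.toLinearMap with hdf
  have hdf' : ∀ p, df (leftTriv g p) = mvfderiv 𝓘(ℝ, E) f g p := fun p => by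
    simp [hdf]
  rw [metricTrace_at hh (hf0 g) (df.smulRight (leftTriv g u) -
    (f g * (2 * ε * negKilling (GroupLieAlgebra 𝓘(ℝ, E) G) x (leftTriv g u))) •
      (negKilling (GroupLieAlgebra 𝓘(ℝ, E) G) x).smulRight x) fun p q => by
      rw [nablaMetric_killingCov hh (hf g), negKilling_comm (leftTriv g q)]
      simp only [LinearMap.sub_apply, LinearMap.smul_apply, LinearMap.smulRight_apply, map_sub,
        map_smul, smul_eq_mul, hdf']
      ring]
  rw [map_sub, map_smul, LinearMap.trace_smulRight, LinearMap.trace_smulRight,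
    negKilling_self_of_isNilpotent_ad hx, smul_zero, sub_zero, hdf']
  ring

/-- The Faraday primitive of `f h` is `df / (2 f)`. -/
theorem faradayPrimitive_killingCov (hx0 : x ≠ 0)
    (hx : IsNilpotent (LieAlgebra.ad ℝ (GroupLieAlgebra 𝓘(ℝ, E) G) x))
    (hh : ∀ y u v, h.form y u v =
      f y * negKilling (GroupLieAlgebra 𝓘(ℝ, E) G) (leftTriv y u) (leftTriv y v))
    {g : G} (hf : MDiffAt f g) (hf0 : f g ≠ 0) (u : TangentSpace 𝓘(ℝ, E) g) :
    faradayPrimitive (killingCov ε x) h g u = (2 * f g)⁻¹ * mvfderiv 𝓘(ℝ, E) f g u := by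
  have h1 := metricTrace_nablaMetric_killingCov (ε := ε) hx hh hf hf0 u
  have h2 : metricTrace (h.at g) (nablaMetric (killingCov ε x) h g) u =
      metricTrace (h.at g) (fun p q => nablaMetric (killingCov ε x) h g p q u) := by
    simp [metricTrace]
  have hn := finrank_ne_zero_of_ne_zero hx0
  rw [faradayPrimitive, smul_apply, h2, h1, smul_eq_mul]
  field_simp

theorem nablaNormalized_killingCov (hx0 : x ≠ 0)
    (hx : IsNilpotent (LieAlgebra.ad ℝ (GroupLieAlgebra 𝓘(ℝ, E) G) x))
    (hh : ∀ y u v, h.form y u v =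
      f y * negKilling (GroupLieAlgebra 𝓘(ℝ, E) G) (leftTriv y u) (leftTriv y v))
    {g : G} (hf : MDiffAt f g) (hf0 : f g ≠ 0) (u v w : TangentSpace 𝓘(ℝ, E) g) :
    nablaNormalized (killingCov ε x) h g v w u =
      -(f g * (2 * ε * negKilling (GroupLieAlgebra 𝓘(ℝ, E) G) x (leftTriv g u) *
        negKilling (GroupLieAlgebra 𝓘(ℝ, E) G) x (leftTriv g v) *
        negKilling (GroupLieAlgebra 𝓘(ℝ, E) G) x (leftTriv g w))) := by
  rw [nablaNormalized, sub_apply, smul_apply, nablaMetric_killingCov hh hf,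
    faradayPrimitive_killingCov hx0 hx hh hf hf0, hh, smul_eq_mul]
  field_simp
  ring

/-- The cubic torsion of `killingCov ε x` is `-2 ε h(x, ·) h(x, ·) x`. -/
theorem metricTrace_nablaNormalized_killingCov (hx0 : x ≠ 0)
    (hx : IsNilpotent (LieAlgebra.ad ℝ (GroupLieAlgebra 𝓘(ℝ, E) G) x))
    (hh : ∀ y u v, h.form y u v =
      f y * negKilling (GroupLieAlgebra 𝓘(ℝ, E) G) (leftTriv y u) (leftTriv y v))
    {g : G} (hf : MDiffAt f g) (hf0 : f g ≠ 0) (u v : TangentSpace 𝓘(ℝ, E) g) :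
    metricTrace (h.at g) (fun p q => nablaNormalized (killingCov ε x) h g v p u • q) =
      (leftTriv g).symm ((-(2 * ε * negKilling (GroupLieAlgebra 𝓘(ℝ, E) G) x (leftTriv g u) *
        negKilling (GroupLieAlgebra 𝓘(ℝ, E) G) x (leftTriv g v))) • x) := by
  have h1 := metricTrace_smul_of_pullback (H := h.at g)
    (β := negKilling (GroupLieAlgebra 𝓘(ℝ, E) G)) (f := f g) (leftTriv g).toLinearEquiv
    negKilling_nondegenerate negKilling_comm hf0
    ((-(2 * ε * negKilling (GroupLieAlgebra 𝓘(ℝ, E) G) x (leftTriv g u) *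
        negKilling (GroupLieAlgebra 𝓘(ℝ, E) G) x (leftTriv g v))) • x) (fun u v => hh g u v)
  refine Eq.trans ?_ h1
  congr 1
  funext p q
  rw [nablaNormalized_killingCov hx0 hx hh hf hf0, map_smul, LinearMap.smul_apply, smul_eq_mul]
  congr 1
  change _ = f g * (_ * negKilling (GroupLieAlgebra 𝓘(ℝ, E) G) x (leftTriv g p))
  ring

/-- Conjugation changes the sign of the cubic term. -/
theorem conjugateCov_killingCov (hx0 : x ≠ 0)
    (hx : IsNilpotent (LieAlgebra.ad ℝ (GroupLieAlgebra 𝓘(ℝ, E) G) x))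
    (hh : ∀ y u v, h.form y u v =
      f y * negKilling (GroupLieAlgebra 𝓘(ℝ, E) G) (leftTriv y u) (leftTriv y v))
    (hf : MDiff f) (hf0 : ∀ g, f g ≠ 0) :
    conjugateCov (killingCov ε x) h = killingCov (-ε) x := by
  funext Y g
  ext u
  apply (leftTriv g).injective
  rw [conjugateCov_apply, metricTrace_nablaNormalized_killingCov hx0 hx hh (hf g) (hf0 g), map_add,
    ContinuousLinearEquiv.apply_symm_apply, leftTriv_leftCov, leftTriv_leftCov,
    christoffel_apply, christoffel_apply]
  module

/-- The metric contributes only the factor `f`, and the correction terms of the definition vanish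
because `cubicWeyl` is trace-free. -/
theorem weylE_killingCov (hx : IsNilpotent (LieAlgebra.ad ℝ (GroupLieAlgebra 𝓘(ℝ, E) G) x))
    (hh : ∀ y u v, h.form y u v =
      f y * negKilling (GroupLieAlgebra 𝓘(ℝ, E) G) (leftTriv y u) (leftTriv y v))
    {g : G} (hf0 : f g ≠ 0) (i j k l : TangentSpace 𝓘(ℝ, E) g) :
    weylE (h.at g) (curv (killingCov ε x) g) (faraday (killingCov ε x) g) i j k l =
      f g * cubicWeyl ε x (leftTriv g i) (leftTriv g j) (leftTriv g k) (leftTriv g l) := by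
  have hU : ∀ i j k l : TangentSpace 𝓘(ℝ, E) g, projSymm (fun a b c d =>
      h.at g (curv (killingCov ε x) g a b c) d -
        rTensor (h.at g) (faraday (killingCov ε x) g) a b c d) i j k l =
      f g * cubicWeyl ε x (leftTriv g i) (leftTriv g j) (leftTriv g k) (leftTriv g l) := by
    intro i j k l
    rw [← projSymm_lieCurv (negKilling_self_of_isNilpotent_ad hx)]
    simp only [projSymm, rTensor, faraday_killingCov hx, PseudoMetric.at, hh, curv_killingCov,
      ContinuousLinearEquiv.apply_symm_apply]
    ring
  have hE : ∀ b c : TangentSpace 𝓘(ℝ, E) g, metricTrace (h.at g) (fun p q =>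
      f g * cubicWeyl ε x (leftTriv g p) (leftTriv g b) (leftTriv g c) (leftTriv g q)) = 0 := by
    intro b c
    obtain ⟨A, hA, htr⟩ := exists_trace_cubicWeyl hx ε (leftTriv g b) (leftTriv g c)
    rw [metricTrace_at hh hf0 (f g • A) fun p q => by simp [hA]]
    simp [htr]
  simp only [weylE, hU, hE]
  simp

end KillingMetric

/-! ### Projective flatness of left-invariant connections -/

section ProjectiveFlatness

variable {E : Type*} [NormedAddCommGroup E] [NormedSpace ℝ E] [FiniteDimensional ℝ E]
  {G : Type*} [TopologicalSpace G] [ChartedSpace E G] [Group G] [LieGroup 𝓘(ℝ, E) ∞ G]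

/-- A connection projectively equivalent to a left-invariant one, on left-invariant fields. -/
theorem leftCoord_projective {Γ : GroupLieAlgebra 𝓘(ℝ, E) G →ₗ[ℝ] GroupLieAlgebra 𝓘(ℝ, E) G →ₗ[ℝ]
    GroupLieAlgebra 𝓘(ℝ, E) G} {cov' : CovOp E G} {U : Set G}
    {σ : (y : G) → TangentSpace 𝓘(ℝ, E) y →L[ℝ] ℝ}
    (hσ : ∀ (Y : VField E G), ∀ y ∈ U, MDiffAt (T% Y) y → ∀ u,
      cov' Y y u = leftCov Γ Y y u + σ y u • Y y + σ y (Y y) • u)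
    {y : G} (hy : y ∈ U) (b c : GroupLieAlgebra 𝓘(ℝ, E) G) :
    leftCoord (fun y => cov' (mulInvariantVectorField c) y (mulInvariantVectorField b y)) y =
      lieCoord E G (Γ b c) + (σ y ((leftTriv y).symm b) • lieCoord E G c +
        σ y ((leftTriv y).symm c) • lieCoord E G b) := by
  have hd : MDiffAt (T% (mulInvariantVectorField c : VField E G)) y :=
    (contMDiff_mulInvariantVectorField_infty c y).mdifferentiableAt (by simp)
  rw [leftCoord, hσ _ y hy hd]
  simp only [map_add, map_smul, leftTriv_leftCov_mulInvariantVectorField,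
    leftTriv_mulInvariantVectorField, leftTriv_symm_apply]
  abel

/-- The one-form relating a left-invariant connection to a smooth connection in its projective class
is differentiable on left-invariant fields. -/
theorem mdifferentiableAt_of_projective {Γ : GroupLieAlgebra 𝓘(ℝ, E) G →ₗ[ℝ]
    GroupLieAlgebra 𝓘(ℝ, E) G →ₗ[ℝ] GroupLieAlgebra 𝓘(ℝ, E) G} {cov' : CovOp E G} {U : Set G}
    (hU : IsOpen U) {σ : (y : G) → TangentSpace 𝓘(ℝ, E) y →L[ℝ] ℝ}
    (hcov' : IsTorsionFreeConnectionOn cov' U)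
    (hσ : ∀ (Y : VField E G), ∀ y ∈ U, MDiffAt (T% Y) y → ∀ u,
      cov' Y y u = leftCov Γ Y y u + σ y u • Y y + σ y (Y y) • u)
    {g : G} (hg : g ∈ U) (b : GroupLieAlgebra 𝓘(ℝ, E) G) :
    MDiffAt (fun y => σ y ((leftTriv y).symm b)) g := by
  by_cases hb : b = 0
  · subst hb
    simp only [map_zero]
    exact mdifferentiableAt_const
  have hb' : lieCoord E G b ≠ 0 := fun h => hb (by simpa using h)
  -- a functional equal to `1` on `b` recovers `2 σ(b)` from `∇'_b b - Γ(b, b)`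
  obtain ⟨l, hl⟩ := SeparatingDual.exists_eq_one (R := ℝ) hb'
  have hW : MDiffAt (leftCoord (fun y : G =>
      cov' (mulInvariantVectorField b) y (mulInvariantVectorField b y))) g :=
    (ContMDiffAt.leftCoord (hcov'.smooth _ _ g hg (contMDiff_mulInvariantVectorField_infty b g)
      (contMDiff_mulInvariantVectorField_infty b g))).mdifferentiableAt (by simp)
  have hF : DifferentiableAt ℝ (fun e : E => (1 / 2 : ℝ) * (l e - l (lieCoord E G (Γ b b))))
      (leftCoord (fun y : G =>
        cov' (mulInvariantVectorField b) y (mulInvariantVectorField b y)) g) := by fun_prop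
  refine (hF.comp_mdifferentiableAt hW).congr_of_eventuallyEq ?_
  filter_upwards [hU.mem_nhds hg] with y hy
  simp only [Function.comp, leftCoord_projective hσ hy, map_add, map_smul, hl, smul_eq_mul]
  ring

/-- If a left-invariant connection becomes flat after adding `σ(a) b + σ(b) a`, its curvature is
determined by the bilinear form `P = ∇σ - σ ⊗ σ` at the identity. -/
theorem exists_lieCurv_add_eq_zero {Γ : GroupLieAlgebra 𝓘(ℝ, E) G →ₗ[ℝ]
    GroupLieAlgebra 𝓘(ℝ, E) G →ₗ[ℝ] GroupLieAlgebra 𝓘(ℝ, E) G}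
    (hΓ : ∀ a b, Γ a b - Γ b a = ⁅a, b⁆) (hflat : IsProjectivelyFlat (leftCov Γ)) :
    ∃ P : GroupLieAlgebra 𝓘(ℝ, E) G →ₗ[ℝ] GroupLieAlgebra 𝓘(ℝ, E) G →ₗ[ℝ] ℝ,
      ∀ a b c, lieCurv (fun u v => Γ u v) a b c + (P a b - P b a) • c + P a c • b - P b c • a =
        0 := by
  obtain ⟨U, hU, h1, cov', ⟨hcov', hcurv⟩, σ, hσ⟩ := hflat 1
  set s : GroupLieAlgebra 𝓘(ℝ, E) G → G → ℝ := fun b y => σ y ((leftTriv y).symm b) with hs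
  have hsd : ∀ b, MDiffAt (s b) 1 := mdifferentiableAt_of_projective hU hcov' hσ h1
  set τ : GroupLieAlgebra 𝓘(ℝ, E) G →ₗ[ℝ] ℝ :=
    (σ 1).toLinearMap ∘ₗ (leftTriv (1 : G)).symm.toLinearEquiv.toLinearMap with hτ
  have hτa : ∀ a, τ a = σ 1 ((leftTriv (1 : G)).symm a) := fun a => rfl
  -- the derivatives of the components of `σ` in the left-invariant frame
  set D : GroupLieAlgebra 𝓘(ℝ, E) G →ₗ[ℝ] GroupLieAlgebra 𝓘(ℝ, E) G →ₗ[ℝ] ℝ :=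
    LinearMap.mk₂ ℝ (fun a b => mvfderiv 𝓘(ℝ, E) (s b) 1 ((leftTriv (1 : G)).symm a))
      (fun a a' b => by rw [map_add, map_add])
      (fun r a b => by rw [map_smul, map_smul])
      (fun a b b' => by
        have e : s (b + b') = fun y => s b y + s b' y := by
          funext y; simp [hs]
        rw [e, mvfderiv_fun_add (hsd b) (hsd b'), add_apply])
      (fun r a b => by
        have e : s (r • b) = fun y => (ContinuousLinearMap.lsmul ℝ ℝ r : ℝ →L[ℝ] ℝ) (s b y) := by
          funext y; simp [hs]
        rw [e, mvfderiv_clm_comp _ (hsd b)]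
        simp) with hD
  have hDa : ∀ a b, D a b = mvfderiv 𝓘(ℝ, E) (s b) 1 ((leftTriv (1 : G)).symm a) :=
    fun a b => rfl
  have hm : ∀ a, CMDiffAt ∞ (T% (mulInvariantVectorField a : VField E G)) 1 := fun a =>
    contMDiff_mulInvariantVectorField_infty a 1
  have hcov1 : ∀ (a c), leftTriv (1 : G) (cov' (mulInvariantVectorField c) 1
      (mulInvariantVectorField a 1)) = Γ a c + τ a • c + τ c • a := by
    intro a c
    rw [hσ _ 1 h1 ((hm c).mdifferentiableAt (by simp))]
    simp only [map_add, map_smul, leftTriv_leftCov_mulInvariantVectorField,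
      leftTriv_mulInvariantVectorField, hτa, leftTriv_symm_apply]
  have key : ∀ a b c, leftTriv (1 : G) (cov' (fun y => cov' (mulInvariantVectorField c) y
      (mulInvariantVectorField b y)) 1 (mulInvariantVectorField a 1)) =
      D a b • c + D a c • b + Γ a (Γ b c + τ b • c + τ c • b) +
        τ a • (Γ b c + τ b • c + τ c • b) + τ (Γ b c + τ b • c + τ c • b) • a := by
    intro a b c
    have hsm := hcov'.smooth _ _ 1 h1 (hm b) (hm c)
    have hder : mvfderiv 𝓘(ℝ, E) (leftCoord (fun y : G =>
        cov' (mulInvariantVectorField c) y (mulInvariantVectorField b y))) 1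
          (mulInvariantVectorField a 1) =
        lieCoord E G (D a b • c + D a c • b) := by
      have hev : leftCoord (fun y : G =>
          cov' (mulInvariantVectorField c) y (mulInvariantVectorField b y)) =ᶠ[nhds 1]
          fun y => lieCoord E G (Γ b c) +
            ((ContinuousLinearMap.toSpanSingleton ℝ (lieCoord E G c)) (s b y) +
              (ContinuousLinearMap.toSpanSingleton ℝ (lieCoord E G b)) (s c y)) := by
        filter_upwards [hU.mem_nhds h1] with y hy
        rw [leftCoord_projective hσ hy]
        simp [hs]
      have d1 : ∀ a b, MDiffAt (fun y =>
          (ContinuousLinearMap.toSpanSingleton ℝ (lieCoord E G a)) (s b y)) 1 := fun a b =>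
        (ContinuousLinearMap.differentiableAt _).comp_mdifferentiableAt (hsd b)
      have d2 : MDiffAt (fun y =>
          (ContinuousLinearMap.toSpanSingleton ℝ (lieCoord E G c)) (s b y) +
            (ContinuousLinearMap.toSpanSingleton ℝ (lieCoord E G b)) (s c y)) 1 :=
        (d1 c b).add (d1 b c)
      rw [mvfderiv_congr_of_eventuallyEq hev, mvfderiv_fun_add mdifferentiableAt_const d2,
        mvfderiv_const, mvfderiv_fun_add (d1 c b) (d1 b c), add_apply,
        add_apply, mvfderiv_clm_comp _ (hsd b), mvfderiv_clm_comp _ (hsd c), map_add, map_smul,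
        map_smul, hDa, hDa, leftTriv_symm_apply]
      simp
    rw [hσ _ 1 h1 (hsm.mdifferentiableAt (by simp))]
    rw [map_add, map_add, leftTriv_leftCov, hder, map_smul, map_smul, hcov1,
      leftTriv_mulInvariantVectorField, ContinuousLinearEquiv.symm_apply_apply, ← hcov1 b c, hτa,
      hτa, ContinuousLinearEquiv.symm_apply_apply, leftTriv_symm_apply]
  refine ⟨D - Γ.compr₂ τ - τ.smulRight τ, fun a b c => ?_⟩
  have h0 := congrArg (leftTriv (1 : G)) (hcurv _ _ _ 1 h1 (hm a) (hm b) (hm c))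
  rw [curvatureField, map_sub, map_sub, key, key, mlieBracket_mulInvariantVectorField, hcov1,
    map_zero] at h0
  rw [← h0]
  simp only [lieCurv, ← hΓ, LinearMap.sub_apply, LinearMap.compr₂_apply,
    LinearMap.smulRight_apply, LinearMap.smul_apply, smul_eq_mul, map_add, map_sub, map_smul]
  module

theorem not_isProjectivelyFlat_killingCov [LieAlgebra.IsKilling ℝ (GroupLieAlgebra 𝓘(ℝ, E) G)]
    {x : GroupLieAlgebra 𝓘(ℝ, E) G} (hx0 : x ≠ 0)
    (hx : IsNilpotent (LieAlgebra.ad ℝ (GroupLieAlgebra 𝓘(ℝ, E) G) x)) {ε : ℝ} (hε : ε ≠ 0) :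
    ¬ IsProjectivelyFlat (killingCov ε x) := fun h => by
  obtain ⟨P, hP⟩ := exists_lieCurv_add_eq_zero (christoffel_sub_swap ε x) h
  exact false_of_lieCurv_add_eq_zero hx hx0 hε P hP

end ProjectiveFlatness

/-! ### The AH structure generated by the cubic deformation -/

section KillingStructure

variable {E : Type*} [NormedAddCommGroup E] [NormedSpace ℝ E] [FiniteDimensional ℝ E]
  {G : Type*} [TopologicalSpace G] [ChartedSpace E G] [Group G] [LieGroup 𝓘(ℝ, E) ∞ G]

/-- `killingCov ε x` as a torsion-free connection. -/
def killingConnection (ε : ℝ) (x : GroupLieAlgebra 𝓘(ℝ, E) G) : Connection E G :=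
  ⟨killingCov ε x, isTorsionFreeConnectionOn_leftCov _ (christoffel_sub_swap ε x)⟩

variable {x : GroupLieAlgebra 𝓘(ℝ, E) G} {ε : ℝ}

/-- The cubic term as the difference from the Levi-Civita connection `killingCov 0 x`. -/
theorem killingCov_apply (Y : VField E G) (g : G) (u : TangentSpace 𝓘(ℝ, E) g) :
    killingCov ε x Y g u = killingCov 0 x Y g u +
      (ε * negKilling (GroupLieAlgebra 𝓘(ℝ, E) G) x (leftTriv g u) *
        negKilling (GroupLieAlgebra 𝓘(ℝ, E) G) x (leftTriv g (Y g))) •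
          mulInvariantVectorField x g := by
  apply (leftTriv g).injective
  rw [map_add, map_smul, leftTriv_mulInvariantVectorField, leftTriv_leftCov, leftTriv_leftCov,
    christoffel_apply, christoffel_apply]
  module

theorem nablaFaraday_killingCov
    (hx : IsNilpotent (LieAlgebra.ad ℝ (GroupLieAlgebra 𝓘(ℝ, E) G) x)) (g : G)
    (u v w : TangentSpace 𝓘(ℝ, E) g) : nablaFaraday (killingCov ε x) g v w u = 0 := by
  simp only [nablaFaraday, faraday_killingCov hx, mvfderiv_const]
  simp

variable [LieAlgebra.IsKilling ℝ (GroupLieAlgebra 𝓘(ℝ, E) G)]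

/-- The connection `killingCov 0 x` is the Levi-Civita connection of the Killing form. -/
theorem nablaMetric_killingConnection_zero (g : G) (u v w : TangentSpace 𝓘(ℝ, E) g) :
    nablaMetric (killingConnection 0 x).cov (killingMetric E G) g v w u = 0 := by
  have hh : ∀ (y : G) (u v : TangentSpace 𝓘(ℝ, E) y), (killingMetric E G).form y u v =
      (fun _ : G => (1 : ℝ)) y *
        negKilling (GroupLieAlgebra 𝓘(ℝ, E) G) (leftTriv y u) (leftTriv y v) := fun y u v => by
    rw [killingMetric_form, one_mul]
  have h := nablaMetric_killingCov (ε := 0) (x := x) hh (g := g) mdifferentiableAt_const u v w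
  rw [mvfderiv_const] at h
  simpa [killingConnection] using h

/-- Membership in the conformal class, with the Killing form written in the left trivialization. -/
theorem exists_conformalFactor {h : PseudoMetric E G}
    (hh : ConformallyEquivalent (killingMetric E G) h) :
    ∃ f : G → ℝ, CMDiff ∞ f ∧ (∀ g, 0 < f g) ∧ ∀ y u v, h.form y u v =
      f y * negKilling (GroupLieAlgebra 𝓘(ℝ, E) G) (leftTriv y u) (leftTriv y v) := hh

/-- The AH structure generated by `killingCov ε x` and the conformal class of the Killing form. -/
def killingAH (hx0 : x ≠ 0) (hx : IsNilpotent (LieAlgebra.ad ℝ (GroupLieAlgebra 𝓘(ℝ, E) G) x))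
    (ε : ℝ) : AHStructure E G where
  proj := {D | ProjectivelyEquivalentOn Set.univ (killingCov ε x) D.cov}
  conf := {h | ConformallyEquivalent (killingMetric E G) h}
  isProjectiveStructure := ⟨killingConnection ε x, rfl⟩
  isConformalStructure := ⟨killingMetric E G, rfl⟩
  aligned := killingConnection ε x
  aligned_mem := ⟨fun _ => 0, fun Y g _ _ u => by simp [killingConnection]⟩
  isAligned := by
    intro h hmem
    obtain ⟨f, hf, hf0, hh⟩ := exists_conformalFactor hmem
    exact aligned_killingCov hx hh (hf.mdifferentiable (by simp)) fun g => (hf0 g).ne'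
  noConformalTorsion := by
    intro h hmem g u v w
    obtain ⟨f, hf, hf0, hh⟩ := exists_conformalFactor hmem
    have hf' : MDiffAt f g := (hf g).mdifferentiableAt (by simp)
    simp only [killingConnection]
    rw [nablaNormalized_killingCov hx0 hx hh hf' (hf0 g).ne',
      nablaNormalized_killingCov hx0 hx hh hf' (hf0 g).ne']
    ring

variable (hx0 : x ≠ 0) (hx : IsNilpotent (LieAlgebra.ad ℝ (GroupLieAlgebra 𝓘(ℝ, E) G) x))

theorem killingMetric_mem_conf : killingMetric E G ∈ (killingAH hx0 hx ε).conf :=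
  ⟨fun _ => 1, contMDiff_const, fun _ => one_pos, fun _ _ _ => (one_mul _).symm⟩

theorem leftInvariant_killingAH : LeftInvariant (killingAH hx0 hx ε) := by
  refine ⟨leftInvariantConnection_leftCov _, ?_⟩
  intro h hmem g
  obtain ⟨f, hf, hf0, hh⟩ := exists_conformalFactor hmem
  refine ⟨fun y => f (g * y) * (f y)⁻¹,
    (hf.comp contMDiff_mul_left).mul (hf.inv₀ fun y => (hf0 y).ne'),
    fun y => mul_pos (hf0 _) (inv_pos.2 (hf0 _)), fun y u v => ?_⟩
  rw [hh, hh, leftTriv_mfderiv_mul_left, leftTriv_mfderiv_mul_left]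
  have := (hf0 y).ne'
  field_simp

theorem proper_killingAH : (killingAH hx0 hx ε).Proper := by
  intro h hmem g
  obtain ⟨f, hf, hf0, hh⟩ := exists_conformalFactor hmem
  have hn := finrank_ne_zero_of_ne_zero hx0
  have hfg := (hf0 g).ne'
  simp only [killingAH, killingConnection]
  rw [scal_killingCov hx hh hfg]
  positivity

theorem naiveEinstein_killingAH : (killingAH hx0 hx ε).NaiveEinstein := by
  intro h hmem g u v
  obtain ⟨f, hf, hf0, hh⟩ := exists_conformalFactor hmem
  have hn := finrank_ne_zero_of_ne_zero hx0
  have hfg := (hf0 g).ne'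
  have hQ : ricciQ (killingCov ε x) h g = ricci (killingCov ε x) g := by
    funext u v
    rw [ricciQ_killingCov hx hh hfg, ricci_killingCov hx]
  have hs := scal_killingCov (ε := ε) hx hh hfg
  rw [scal] at hs
  simp only [killingAH, killingConnection]
  rw [hQ, and_self, hs, ricci_killingCov hx, ricci_killingCov hx, PseudoMetric.at, hh,
    negKilling_comm (leftTriv g v)]
  field_simp
  ring

/-- The scalar curvature `n / (4 f)` and the Faraday primitive `df / (2 f)` of `f h` compensate each
other, and the Faraday form vanishes. -/
theorem conservative_killingAH : (killingAH hx0 hx ε).Conservative := by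
  intro h hmem g u
  obtain ⟨f, hf, hf0, hh⟩ := exists_conformalFactor hmem
  have hfg := (hf0 g).ne'
  have hfd : MDiffAt f g := (hf g).mdifferentiableAt (by simp)
  have hs : scal (killingCov ε x) h = fun y => (Module.finrank ℝ E : ℝ) / 4 * (f y)⁻¹ := by
    funext y
    exact scal_killingCov hx hh (hf0 y).ne'
  have hΦ := ((hasDerivAt_inv hfg).const_mul ((Module.finrank ℝ E : ℝ) / 4)).hasFDerivAt
  simp only [killingAH, killingConnection]
  rw [hs, mvfderiv_comp_hasFDerivAt hfd hΦ, faradayPrimitive_killingCov hx0 hx hh hfd hfg]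
  simp only [nablaFaraday_killingCov hx, metricTrace]
  simp
  field_simp
  ring

theorem exists_antiSelfConjugateWeyl_killingAH_ne_zero (hε : ε ≠ 0) {h : PseudoMetric E G}
    (hmem : h ∈ (killingAH hx0 hx ε).conf) : ∃ (g : G) (u v w z : TangentSpace 𝓘(ℝ, E) g),
      (killingAH hx0 hx ε).antiSelfConjugateWeyl h g u v w z ≠ 0 := by
  obtain ⟨f, hf, hf0, hh⟩ := exists_conformalFactor hmem
  obtain ⟨i, j, k, l, hne⟩ := exists_cubicWeyl_ne_zero hx0 hε
  refine ⟨1, (leftTriv 1).symm i, (leftTriv 1).symm j, (leftTriv 1).symm k, (leftTriv 1).symm l, ?_⟩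
  simp only [AHStructure.antiSelfConjugateWeyl, killingAH, killingConnection]
  rw [weylE_killingCov hx hh (hf0 1).ne']
  simpa using ⟨(hf0 1).ne', hne⟩

theorem not_projectivelyFlat_killingAH (hε : ε ≠ 0) : ¬ (killingAH hx0 hx ε).ProjectivelyFlat :=
  fun h => not_isProjectivelyFlat_killingCov hx0 hx hε (h _ (killingAH hx0 hx ε).aligned_mem)

theorem not_conjugateProjectivelyFlat_killingAH (hε : ε ≠ 0) :
    ¬ (killingAH hx0 hx ε).ConjugateProjectivelyFlat := fun h => by
  have h1 := h _ (killingMetric_mem_conf hx0 hx)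
  have h2 : conjugateCov (killingCov ε x) (killingMetric E G) = killingCov (-ε) x :=
    conjugateCov_killingCov (f := fun _ => 1) hx0 hx (fun _ _ _ => (one_mul _).symm)
      (fun _ => mdifferentiableAt_const) fun _ => one_ne_zero
  simp only [killingAH, killingConnection] at h1
  rw [h2] at h1
  exact not_isProjectivelyFlat_killingCov hx0 hx (neg_ne_zero.2 hε) h1

end KillingStructure

end AH

end

theorem mainTheorem9 {E : Type*} [NormedAddCommGroup E] [NormedSpace ℝ E] [FiniteDimensional ℝ E]
    {G : Type*} [TopologicalSpace G] [ChartedSpace E G] [Group G] [LieGroup 𝓘(ℝ, E) ∞ G]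
    [T2Space G] [NoncompactSpace G]
    [LieAlgebra.IsSemisimple ℝ (GroupLieAlgebra 𝓘(ℝ, E) G)]
    (x : GroupLieAlgebra 𝓘(ℝ, E) G) (hx : x ≠ 0)
    (hnil : IsNilpotent (LieAlgebra.ad ℝ (GroupLieAlgebra 𝓘(ℝ, E) G) x)) :
    ∃ (h : AH.PseudoMetric E G) (D : AH.Connection E G) (S : AH.AHStructure E G),
      -- `h` is the left-invariant metric given by the negative of the Killing form
      (∀ (a b : GroupLieAlgebra 𝓘(ℝ, E) G) (g : G),
        h.form g (mulInvariantVectorField a g) (mulInvariantVectorField b g) =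
          -killingForm ℝ (GroupLieAlgebra 𝓘(ℝ, E) G) a b) ∧
      -- `D` is the Levi-Civita connection of `h`
      (∀ (g : G) (u v w : TangentSpace 𝓘(ℝ, E) g), AH.nablaMetric D.cov h g v w u = 0) ∧
      -- the conformal structure is `[h]` and the aligned connection is `D + X ⊗ X ⊗ X`
      h ∈ S.conf ∧
      (∀ (Y : AH.VField E G) (g : G), MDiffAt (T% Y) g → ∀ u : TangentSpace 𝓘(ℝ, E) g,
        S.aligned.cov Y g u = D.cov Y g u +
          (h.form g (mulInvariantVectorField x g) u *
            h.form g (mulInvariantVectorField x g) (Y g)) • mulInvariantVectorField x g) ∧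
      AH.LeftInvariant S ∧
      S.Proper ∧
      S.Einstein ∧
      (∀ h' ∈ S.conf, ∃ (g : G) (u v w z : TangentSpace 𝓘(ℝ, E) g),
        S.antiSelfConjugateWeyl h' g u v w z ≠ 0) ∧
      ¬ S.ProjectivelyFlat ∧
      ¬ S.ConjugateProjectivelyFlat := by
  refine ⟨AH.killingMetric E G, AH.killingConnection 0 x, AH.killingAH hx hnil 1, fun a b g => ?_,
    AH.nablaMetric_killingConnection_zero, AH.killingMetric_mem_conf hx hnil, fun Y g _ u => ?_,
    AH.leftInvariant_killingAH hx hnil, AH.proper_killingAH hx hnil,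
    ⟨AH.naiveEinstein_killingAH hx hnil, AH.conservative_killingAH hx hnil⟩,
    fun h' hh' => AH.exists_antiSelfConjugateWeyl_killingAH_ne_zero hx hnil one_ne_zero hh',
    AH.not_projectivelyFlat_killingAH hx hnil one_ne_zero,
    AH.not_conjugateProjectivelyFlat_killingAH hx hnil one_ne_zero⟩
  · rw [AH.killingMetric_form, AH.leftTriv_mulInvariantVectorField,
      AH.leftTriv_mulInvariantVectorField]
    rfl
  · rw [AH.killingMetric_form, AH.killingMetric_form, AH.leftTriv_mulInvariantVectorField]
    refine (AH.killingCov_apply Y g u).trans ?_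
    rw [one_mul]
    rfl
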